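/- Let $a,b>-2$. For $\alpha,\beta>-1$ let $P_j^{(\alpha,\beta)}$ ($j=0,1,2,\ldots$) be the Jacobi polynomials on $[-1,1]$, with $$\int_{-1}^{1}P_j^{(\alpha,\beta)}(x)P_k^{(\alpha,\beta)}(x)(1-x)^{\alpha}(1+x)^{\beta}\,dx=h_j^{(\alpha,\beta)}\delta_{jk}.$$ For $x,y\in(-1,1)$ put $$\varphi_j^{(1)}(x)=\frac{P_j^{(a+1,b+1)}(x)}{\sqrt{h_j^{(a+1,b+1)}}}(1-x)^{a/2}(1+x)^{b/2},\qquad S_N^{(1)}(x,y)=\sum_{j=0}^{N-1}(1-x^2)\varphi_j^{(1)}(x)\varphi_j^{(1)}(y).$$ Let $J_\nu$ be the Bessel function of the first kind of order $\nu$, and for $x,y>0$ let $$K_{\mathrm{Bessel}}^{(\nu)}(x,y)=\frac{J_{\nu}(\sqrt{x})\sqrt{y}\,J_{\nu}'(\sqrt{y})-J_{\nu}'(\sqrt{x})\sqrt{x}\,J_{\nu}(\sqrt{y})}{2(x-y)}\quad(x\neq y),$$ $$K_{\mathrm{Bessel}}^{(\nu)}(x,x)=\frac{J_\nu(\sqrt{x})^2-J_{\nu+1}(\sqrt{x})J_{\nu-1}(\sqrt{x})}{4}$$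 be the Bessel kernel of order $\nu$. Then for $x,y\in\mathbb{R}^{+}=(0,\infty)$, as $N\to\infty$, $$\frac{1}{2N^2}S_{N}^{(1)}\left(1-\frac{x}{2N^2},1-\frac{y}{2N^2}\right)=\sqrt{\frac{x}{y}}\;K_{\mathrm{Bessel}}^{(a+1)}(x,y)+O(N^{-1}),$$ and the error term is uniform for $x$ and $y$ in compact subsets of $\mathbb{R}^{+}$. That is, for every compact $K\subset(0,\infty)$ there are $C$ and $N_0$, depending only on $a$, $b$ and $K$, such that for all $N\ge N_0$ and all $x,y\in K$ the two sides differ, without the error term, by at most $C/N$ in absolute value. -/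

import Mathlib

open scoped Nat

noncomputable section

/-- The Jacobi polynomial `P_n^{(α,β)}` in the standard normalisation `P_n^{(α,β)}(1) = (α+1)_n / n!`:
`P_n^{(α,β)}(x) = (1/n!) ∑_k C(n,k) (n+α+β+1)_k (α+k+1)_{n-k} ((x-1)/2)^k`,
where `(c)_k = c (c+1) ⋯ (c+k-1)`. -/
def jacobiP (α β : ℝ) (n : ℕ) (x : ℝ) : ℝ :=
  (1 / (n ! : ℝ)) * ∑ k ∈ Finset.range (n + 1),
    (n.choose k : ℝ) * (ascPochhammer ℝ k).eval ((n : ℝ) + α + β + 1) *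
      (ascPochhammer ℝ (n - k)).eval (α + (k : ℝ) + 1) * ((x - 1) / 2) ^ k

/-- `h_n^{(α,β)} = ∫_{-1}^{1} P_n^{(α,β)}(x)² (1-x)^α (1+x)^β dx`. -/
def jacobiNormSq (α β : ℝ) (n : ℕ) : ℝ :=
  ∫ x in (-1 : ℝ)..1, jacobiP α β n x ^ 2 * (1 - x) ^ α * (1 + x) ^ β

/-- `φ_j^{(1)}(x) = P_j^{(a+1,b+1)}(x) / √h_j^{(a+1,b+1)} · (1-x)^{a/2} (1+x)^{b/2}`. -/
def joePhi (a b : ℝ) (j : ℕ) (x : ℝ) : ℝ :=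
  jacobiP (a + 1) (b + 1) j x / √(jacobiNormSq (a + 1) (b + 1) j) *
    (1 - x) ^ (a / 2) * (1 + x) ^ (b / 2)

/-- `S_N^{(1)}(x,y) = ∑_{j=0}^{N-1} (1-x²) φ_j^{(1)}(x) φ_j^{(1)}(y)`. -/
def joeS (a b : ℝ) (N : ℕ) (x y : ℝ) : ℝ :=
  ∑ j ∈ Finset.range N, (1 - x ^ 2) * joePhi a b j x * joePhi a b j y

/-- The Bessel function of the first kind of real order `ν`, at `x > 0`:
`J_ν(x) = ∑_{m ≥ 0} (-1)^m / (m! Γ(m+ν+1)) (x/2)^{2m+ν}`. (The reciprocal of `Gamma` is `0`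
at the poles of the Gamma function, as it should be.) -/
def besselJ (ν x : ℝ) : ℝ :=
  ∑' m : ℕ, (-1) ^ m / ((m ! : ℝ) * Real.Gamma ((m : ℝ) + ν + 1)) *
    (x / 2) ^ (2 * (m : ℝ) + ν)

/-- The Bessel kernel of order `ν` on `(0,∞) × (0,∞)`, with its limiting value on the diagonal. -/
def besselKernel (ν x y : ℝ) : ℝ :=
  if x = y then
    (besselJ ν (√x) ^ 2 - besselJ (ν + 1) (√x) * besselJ (ν - 1) (√x)) / 4
  else
    (besselJ ν (√x) * √y * deriv (besselJ ν) (√y) -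
      deriv (besselJ ν) (√x) * √x * besselJ ν (√y)) / (2 * (x - y))

end

/-! With `u = (1 - x) / 2` and `σ = α + β + 1`, the polynomial `P_n^{(α,β)}` is, up to a constant,
`Q_n(u) = ₂F₁(-n, n+σ; α+1; u) / Γ(α+1)`. Its k-th coefficient is the k-th coefficient of `z^{-α/2}
J_α(2√z)` times a product `∏ (n-i)(n+σ+i)`, which is `n^{2k} (1 + O(1/n))`. Hence `Q_n(z/n²)` tends
to the Bessel series. The relative error grows at most geometrically in k while the Bessel
coefficients decay like `B^k / k!`, so the rate `1/n` is uniform on bounded sets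
(`abs_jacCoef_div_sub_one_le`, `exists_expBdd_scaledCoef`).

Christoffel–Darboux (`christoffel_darboux`) writes the sum as `(u R(u) Q(v) - Q(u) v R(v)) / (u -
v)` times a Gamma quotient, where `R` is a contiguous polynomial of order `α+1`. The Bessel kernel
is the same expression in the limiting series (`besselKernel_eq`). To avoid dividing by a small `x -
y`, the quotient is expressed through divided differences of power series (`pdd`, `cdKernel`); these
obey bounds of the same type as the series, so the diagonal needs no separate estimate.

What remains is constants: the norms `h_n` come from Beta integrals and Chu–Vandermonde, and
log-convexity of Gamma gives `cdCoef α β N = N^{2α+2} (1 + O(1/N))`. Here `α = a+1`, `β = b+1`, and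
`1 - x/(2N²) = 1 - 2u` with `u = (x/4)/N²`. -/

/-! ### Power series with coefficients bounded by those of an exponential -/

/-- The sum of the power series with coefficients `c`. -/
noncomputable def pser (c : ℕ → ℝ) (x : ℝ) : ℝ := ∑' k, c k * x ^ k

/-- The divided difference of the power series with coefficients `c`. -/
noncomputable def pdd (c : ℕ → ℝ) (x y : ℝ) : ℝ :=
  ∑' k, c k * ∑ i ∈ Finset.range k, x ^ i * y ^ (k - 1 - i)

/-- `|c k| ≤ C B ^ k / k!` for all `k`. -/
def ExpBdd (C B : ℝ) (c : ℕ → ℝ) : Prop := ∀ k, |c k| ≤ C * (B ^ k / (k ! : ℝ))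

theorem hasSum_exp_bound (C t : ℝ) :
    HasSum (fun k : ℕ => C * (t ^ k / (k ! : ℝ))) (C * Real.exp t) := by
  have h := NormedSpace.expSeries_div_hasSum_exp (𝔸 := ℝ) t
  rw [← Real.exp_eq_exp_ℝ] at h
  exact h.mul_left C

theorem ExpBdd.term_le {C B R x : ℝ} {c : ℕ → ℝ} (h : ExpBdd C B c) (hx : |x| ≤ R) (k : ℕ) :
    ‖c k * x ^ k‖ ≤ C * ((B * R) ^ k / (k ! : ℝ)) := by
  rw [Real.norm_eq_abs, abs_mul, abs_pow, mul_pow]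
  calc |c k| * |x| ^ k ≤ C * (B ^ k / (k ! : ℝ)) * R ^ k :=
        mul_le_mul (h k) (pow_le_pow_left₀ (abs_nonneg _) hx k) (by positivity)
          ((abs_nonneg _).trans (h k))
    _ = _ := by ring

/-- Crude on purpose: `k ≤ 2^k` keeps the bound geometric, so a divided difference is dominated by
an exponential series just as the series itself is. -/
theorem abs_geom_sum₂_le {R x y : ℝ} (hR : 1 ≤ R) (hx : |x| ≤ R) (hy : |y| ≤ R) (k : ℕ) :
    |∑ i ∈ Finset.range k, x ^ i * y ^ (k - 1 - i)| ≤ (2 * R) ^ k := by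
  have hR0 : 0 ≤ R := by linarith
  calc |∑ i ∈ Finset.range k, x ^ i * y ^ (k - 1 - i)|
      ≤ ∑ i ∈ Finset.range k, |x ^ i * y ^ (k - 1 - i)| := Finset.abs_sum_le_sum_abs _ _
    _ ≤ ∑ i ∈ Finset.range k, R ^ k := by
        refine Finset.sum_le_sum fun i hi => ?_
        have hi' : i < k := Finset.mem_range.mp hi
        rw [abs_mul, abs_pow, abs_pow]
        calc |x| ^ i * |y| ^ (k - 1 - i) ≤ R ^ i * R ^ (k - 1 - i) := by gcongr
          _ = R ^ (i + (k - 1 - i)) := by rw [pow_add]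
          _ ≤ R ^ k := pow_le_pow_right₀ hR (by omega)
    _ = k * R ^ k := by simp
    _ ≤ 2 ^ k * R ^ k := by
        gcongr
        exact_mod_cast Nat.lt_two_pow_self.le
    _ = _ := by rw [mul_pow]

theorem ExpBdd.dd_term_le {C B R x y : ℝ} {c : ℕ → ℝ} (h : ExpBdd C B c) (hR : 1 ≤ R)
    (hx : |x| ≤ R) (hy : |y| ≤ R) (k : ℕ) :
    ‖c k * ∑ i ∈ Finset.range k, x ^ i * y ^ (k - 1 - i)‖ ≤
      C * ((B * (2 * R)) ^ k / (k ! : ℝ)) := by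
  rw [Real.norm_eq_abs, abs_mul, mul_pow B]
  calc |c k| * |∑ i ∈ Finset.range k, x ^ i * y ^ (k - 1 - i)|
      ≤ C * (B ^ k / (k ! : ℝ)) * (2 * R) ^ k :=
        mul_le_mul (h k) (abs_geom_sum₂_le hR hx hy k) (by positivity)
          ((abs_nonneg _).trans (h k))
    _ = _ := by ring

theorem ExpBdd.summable {C B : ℝ} {c : ℕ → ℝ} (h : ExpBdd C B c) (x : ℝ) :
    Summable fun k => c k * x ^ k :=
  .of_norm_bounded (hasSum_exp_bound C _).summable (h.term_le le_rfl)

theorem ExpBdd.dd_summable {C B : ℝ} {c : ℕ → ℝ} (h : ExpBdd C B c) (x y : ℝ) :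
    Summable fun k => c k * ∑ i ∈ Finset.range k, x ^ i * y ^ (k - 1 - i) :=
  .of_norm_bounded (hasSum_exp_bound C _).summable
    (h.dd_term_le (R := max 1 (max |x| |y|)) (le_max_left _ _) (by simp) (by simp))

theorem ExpBdd.abs_pser_le {C B R x : ℝ} {c : ℕ → ℝ} (h : ExpBdd C B c) (hx : |x| ≤ R) :
    |pser c x| ≤ C * Real.exp (B * R) :=
  tsum_of_norm_bounded (hasSum_exp_bound C _) (h.term_le hx)

theorem ExpBdd.abs_pdd_le {C B R x y : ℝ} {c : ℕ → ℝ} (h : ExpBdd C B c) (hR : 1 ≤ R)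
    (hx : |x| ≤ R) (hy : |y| ≤ R) :
    |pdd c x y| ≤ C * Real.exp (B * (2 * R)) :=
  tsum_of_norm_bounded (hasSum_exp_bound C _) (h.dd_term_le hR hx hy)

theorem ExpBdd.pser_sub {C B C' B' : ℝ} {c c' : ℕ → ℝ} (h : ExpBdd C B c) (h' : ExpBdd C' B' c')
    (x : ℝ) : pser (fun k => c k - c' k) x = pser c x - pser c' x := by
  unfold pser
  rw [← (h.summable x).tsum_sub (h'.summable x)]
  exact tsum_congr fun k => by ring

theorem ExpBdd.pdd_sub {C B C' B' : ℝ} {c c' : ℕ → ℝ} (h : ExpBdd C B c) (h' : ExpBdd C' B' c')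
    (x y : ℝ) : pdd (fun k => c k - c' k) x y = pdd c x y - pdd c' x y := by
  unfold pdd
  rw [← (h.dd_summable x y).tsum_sub (h'.dd_summable x y)]
  exact tsum_congr fun k => by ring

theorem ExpBdd.sub_mul_pdd {C B : ℝ} {c : ℕ → ℝ} (h : ExpBdd C B c) (x y : ℝ) :
    (x - y) * pdd c x y = pser c x - pser c y := by
  unfold pdd pser
  rw [← tsum_mul_left, ← (h.summable x).tsum_sub (h.summable y)]
  refine tsum_congr fun k => ?_
  rw [← mul_sub, ← (Commute.all x y).geom_sum₂_mul]
  ring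

theorem pdd_self (c : ℕ → ℝ) (x : ℝ) : pdd c x x = ∑' k, c k * (k * x ^ (k - 1)) := by
  unfold pdd
  exact tsum_congr fun k => by rw [geom_sum₂_self]

theorem ExpBdd.hasDerivAt_pser {C B : ℝ} {c : ℕ → ℝ} (h : ExpBdd C B c) (x : ℝ) :
    HasDerivAt (pser c) (pdd c x x) x := by
  rw [pdd_self]
  refine hasDerivAt_tsum_of_isPreconnected
    (hasSum_exp_bound C (B * (2 * (|x| + 1)))).summable Metric.isOpen_ball
    (convex_ball (0 : ℝ) (|x| + 1)).isPreconnected (y₀ := x)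
    (fun k y _ => (hasDerivAt_pow k y).const_mul (c k)) (fun k y hy => ?_) (by simp)
    (h.summable x) (by simp)
  have hy' : |y| ≤ |x| + 1 := by simpa using (Metric.mem_ball.mp hy).le
  have := h.dd_term_le (by linarith [abs_nonneg x]) hy' hy' k
  rwa [geom_sum₂_self] at this

theorem mul_pdd_self (c : ℕ → ℝ) (x : ℝ) : x * pdd c x x = pser (fun k => k * c k) x := by
  rw [pdd_self, pser, ← tsum_mul_left]
  refine tsum_congr fun k => ?_
  cases k with
  | zero => simp
  | succ k => rw [Nat.add_sub_cancel, pow_succ]; ring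

theorem ExpBdd.pdd_self_eq_pser {C B : ℝ} {c : ℕ → ℝ} (h : ExpBdd C B c) (x : ℝ) :
    pdd c x x = pser (fun k => (k + 1) * c (k + 1)) x := by
  have hs := h.dd_summable x x
  simp_rw [geom_sum₂_self] at hs
  rw [pdd_self, hs.tsum_eq_zero_add, pser]
  simp only [Nat.cast_zero, zero_mul, mul_zero, zero_add, Nat.add_sub_cancel, Nat.cast_add,
    Nat.cast_one]
  exact tsum_congr fun k => by ring

/-! ### The coefficients of the Bessel and Jacobi series -/

/-- The coefficients of `∑ (-1)^k / (k! Γ(k+ν+1)) z^k = z^{-ν/2} J_ν(2√z)`. -/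
noncomputable def besselCoef (ν : ℝ) (k : ℕ) : ℝ :=
  (-1) ^ k / ((k ! : ℝ) * Real.Gamma ((k : ℝ) + ν + 1))

/-- `jacCoef x y k = x (x-1) ⋯ (x-k+1) · y (y+1) ⋯ (y+k-1)`. -/
noncomputable def jacCoef (x y : ℝ) (k : ℕ) : ℝ :=
  ∏ i ∈ Finset.range k, (x - i) * (y + i)

/-- The functional equation of the entire function `1/Γ`. The convention `0⁻¹ = 0` makes it hold at
the poles too, so the coefficient recurrences need no condition on the order. -/
theorem Real.inv_Gamma_eq (s : ℝ) : (Real.Gamma s)⁻¹ = s * (Real.Gamma (s + 1))⁻¹ := by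
  rcases eq_or_ne s 0 with rfl | hs
  · simp
  · rw [Real.Gamma_add_one hs, mul_inv, mul_inv_cancel_left₀ hs]

theorem besselCoef_eq (ν : ℝ) (k : ℕ) :
    besselCoef ν k = (k + (ν + 1)) * besselCoef (ν + 1) k := by
  have h := Real.inv_Gamma_eq ((k : ℝ) + ν + 1)
  rw [besselCoef, besselCoef, div_eq_mul_inv, div_eq_mul_inv, mul_inv, mul_inv, h,
    show (k : ℝ) + (ν + 1) + 1 = k + ν + 1 + 1 by ring]
  ring

/-- Coefficient form of `d/dz (z^{-ν/2} J_ν(2√z)) = -z^{-(ν+1)/2} J_{ν+1}(2√z)`. -/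
theorem succ_mul_besselCoef_succ (ν : ℝ) (k : ℕ) :
    ((k : ℝ) + 1) * besselCoef ν (k + 1) = -besselCoef (ν + 1) k := by
  rw [besselCoef, besselCoef, Nat.factorial_succ, pow_succ]
  push_cast
  rw [show (k : ℝ) + 1 + ν + 1 = k + (ν + 1) + 1 by ring]
  have : (k : ℝ) + 1 ≠ 0 := by positivity
  field_simp

theorem expBdd_besselCoef_of_nonneg {ν : ℝ} (hν : 0 ≤ ν) :
    ExpBdd (Real.Gamma (ν + 1))⁻¹ 1 (besselCoef ν) := by
  intro k
  have hG : 0 < Real.Gamma (ν + 1) := Real.Gamma_pos_of_pos (by linarith)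
  have hmono : ∀ k : ℕ, Real.Gamma (ν + 1) ≤ Real.Gamma ((k : ℝ) + ν + 1) := by
    intro k
    induction k with
    | zero => simp
    | succ k ih =>
      have h1 : (1 : ℝ) ≤ k + ν + 1 := by linarith [Nat.cast_nonneg (α := ℝ) k]
      push_cast
      rw [show (k : ℝ) + 1 + ν + 1 = (k + ν + 1) + 1 by ring,
        Real.Gamma_add_one (s := k + ν + 1) (by linarith)]
      nlinarith
  have hk := hmono k
  have hf : (0 : ℝ) < k ! := by positivity
  rw [besselCoef, abs_div, abs_pow, abs_neg, abs_one, one_pow, abs_mul, abs_of_pos hf,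
    abs_of_pos (hG.trans_le hk), one_div, mul_inv, one_div, mul_comm]
  gcongr

/-- For `ν ≥ 0` the Gamma values in the denominator are at least `Γ(ν+1)`. Lowering the order by one
costs a factor linear in k, absorbed by doubling `B`; finitely many steps reach any real order. -/
theorem exists_expBdd_besselCoef (ν : ℝ) :
    ∃ C B, 0 ≤ C ∧ 0 ≤ B ∧ ExpBdd C B (besselCoef ν) := by
  suffices ∀ n : ℕ, ∀ μ : ℝ, 0 ≤ μ + n → ∃ C B, 0 ≤ C ∧ 0 ≤ B ∧ ExpBdd C B (besselCoef μ) by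
    obtain ⟨n, hn⟩ := exists_nat_ge (-ν)
    exact this n ν (by linarith)
  intro n
  induction n with
  | zero =>
    intro μ hμ
    have hμ' : 0 ≤ μ := by simpa using hμ
    exact ⟨_, 1, (inv_pos.mpr (Real.Gamma_pos_of_pos (by linarith))).le, zero_le_one,
      expBdd_besselCoef_of_nonneg hμ'⟩
  | succ n ih =>
    intro μ hμ
    obtain ⟨C, B, hC, hB, h⟩ := ih (μ + 1) (by push_cast at hμ; linarith)
    refine ⟨(1 + |μ + 1|) * C, 2 * B, by positivity, by positivity, fun k => ?_⟩
    rw [besselCoef_eq, abs_mul, mul_pow]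
    have h1 : |(k : ℝ) + (μ + 1)| ≤ (1 + |μ + 1|) * 2 ^ k := by
      have h2 : (k : ℝ) ≤ 2 ^ k := by exact_mod_cast Nat.lt_two_pow_self.le
      have h3 : (1 : ℝ) ≤ 2 ^ k := one_le_pow₀ (by norm_num)
      have h4 := abs_add_le (k : ℝ) (μ + 1)
      rw [Nat.abs_cast] at h4
      nlinarith [abs_nonneg (μ + 1)]
    calc |(k : ℝ) + (μ + 1)| * |besselCoef (μ + 1) k|
        ≤ (1 + |μ + 1|) * 2 ^ k * (C * (B ^ k / (k ! : ℝ))) :=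
          mul_le_mul h1 (h k) (abs_nonneg _) (by positivity)
      _ = _ := by ring

theorem jacCoef_succ (x y : ℝ) (k : ℕ) :
    jacCoef x y (k + 1) = jacCoef x y k * ((x - k) * (y + k)) := by
  rw [jacCoef, Finset.prod_range_succ, jacCoef]

theorem mul_jacCoef_add_one (x y : ℝ) (k : ℕ) :
    y * jacCoef x (y + 1) k = (y + k) * jacCoef x y k := by
  induction k with
  | zero => simp [jacCoef]
  | succ k ih =>
    rw [jacCoef_succ, jacCoef_succ, ← mul_assoc, ih]
    push_cast
    ring

theorem mul_jacCoef_sub_one (x y : ℝ) (k : ℕ) :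
    x * jacCoef (x - 1) y k = (x - k) * jacCoef x y k := by
  induction k with
  | zero => simp [jacCoef]
  | succ k ih =>
    rw [jacCoef_succ, jacCoef_succ, ← mul_assoc, ih]
    push_cast
    ring

theorem jacCoef_succ_left (x y : ℝ) (k : ℕ) :
    jacCoef (x + 1) y (k + 1) = (x + 1) * ((y + k) * jacCoef x y k) := by
  have h := mul_jacCoef_sub_one (x + 1) y k
  rw [add_sub_cancel_right] at h
  rw [jacCoef_succ]
  linear_combination -(y + k) * h

theorem jacCoef_succ_right (x y : ℝ) (k : ℕ) :
    jacCoef x y (k + 1) = y * ((x - k) * jacCoef x (y + 1) k) := by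
  have h := mul_jacCoef_add_one x y k
  rw [jacCoef_succ]
  linear_combination -(x - k) * h

theorem jacCoef_nat_eq_zero (n : ℕ) (y : ℝ) {k : ℕ} (h : n < k) : jacCoef n y k = 0 :=
  Finset.prod_eq_zero (Finset.mem_range.mpr h) (by simp)

theorem jacCoef_sub_one_eq_zero {n : ℕ} (hn : 1 ≤ n) (y : ℝ) {k : ℕ} (h : n ≤ k) :
    jacCoef ((n : ℝ) - 1) y k = 0 :=
  Finset.prod_eq_zero (Finset.mem_range.mpr (show n - 1 < k by omega)) (by simp [Nat.cast_sub hn])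

/-- `jacCoef (N - δ) (N + σ) k / N ^ (2 k)` is close to `1`, uniformly enough in `k`. -/
theorem abs_jacCoef_div_sub_one_le {δ : ℕ} (hδ : δ ≤ 1) (σ : ℝ) {N : ℕ} (hN : 1 ≤ N) (k : ℕ) :
    |jacCoef ((N : ℝ) - δ) (N + σ) k / ((N : ℝ) ^ 2) ^ k - 1| ≤
      2 * (2 + |σ|) / N * (4 * (2 + |σ|)) ^ k := by
  have hN0 : (1 : ℝ) ≤ N := by exact_mod_cast hN
  have hNpos : (0 : ℝ) < N := by linarith
  have hδ' : (δ : ℝ) ≤ 1 := by exact_mod_cast hδ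
  have hδ0 : (0 : ℝ) ≤ δ := by positivity
  set A : ℝ := 2 + |σ| with hA
  have hA2 : 2 ≤ A := by linarith [abs_nonneg σ]
  have hA0 : 0 ≤ A := by linarith
  set t : ℕ → ℝ := fun i => (((N : ℝ) - δ) - i) * (N + σ + i) / (N : ℝ) ^ 2 with ht
  set p : ℕ → ℝ := fun k => jacCoef ((N : ℝ) - δ) (N + σ) k / ((N : ℝ) ^ 2) ^ k with hp
  have hp0 : p 0 = 1 := by simp [hp, jacCoef]
  have hps : ∀ k, p (k + 1) = p k * t k := by
    intro k
    simp only [hp, ht]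
    rw [jacCoef_succ, pow_succ]
    field_simp
  -- The ratio `t k` is bounded by `A` only while `k + δ ≤ N`. At `k + δ = N` a factor vanishes, and
  -- the product is zero from then on.
  have hbound : ∀ k, |p k| ≤ A ^ k ∧ (N < k + δ → p k = 0) := by
    intro k
    induction k with
    | zero => exact ⟨by simp [hp0], fun h => by omega⟩
    | succ k ih =>
      rw [hps]
      rcases lt_trichotomy (k + δ) N with hk | hk | hk
      · refine ⟨?_, fun h => by omega⟩
        have hk' : (k : ℝ) + δ ≤ N := by exact_mod_cast hk.le
        have hk0 : (0 : ℝ) ≤ k := by positivity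
        rw [abs_mul, pow_succ]
        refine mul_le_mul ih.1 ?_ (abs_nonneg _) (by positivity)
        simp only [ht]
        rw [abs_div, abs_mul, abs_of_nonneg (a := (N : ℝ) - δ - k) (by linarith),
          abs_of_pos (a := (N : ℝ) ^ 2) (by positivity), div_le_iff₀ (by positivity), hA]
        have h1 : |(N : ℝ) + σ + k| ≤ (2 + |σ|) * N := by
          have := abs_add_three (N : ℝ) σ k
          rw [Nat.abs_cast, Nat.abs_cast] at this
          nlinarith [abs_nonneg σ]
        calc ((N : ℝ) - δ - k) * |(N : ℝ) + σ + k| ≤ N * ((2 + |σ|) * N) :=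
              mul_le_mul (by linarith) h1 (abs_nonneg _) hNpos.le
          _ = _ := by ring
      · have h0 : t k = 0 := by
          have : (N : ℝ) - δ - k = 0 := by rw [← hk]; push_cast; ring
          simp only [ht]
          rw [this, zero_mul, zero_div]
        rw [h0, mul_zero, abs_zero]
        exact ⟨by positivity, fun _ => rfl⟩
      · rw [ih.2 hk, zero_mul, abs_zero]
        exact ⟨by positivity, fun _ => rfl⟩
  -- The true size is `O((k+1)² / N)`; the square is traded for `4^k`.
  have htk : ∀ k, |t k - 1| ≤ 2 * A / N * 4 ^ k := by
    intro k
    have hk0 : (0 : ℝ) ≤ k := by positivity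
    have h2 : (k : ℝ) + 1 ≤ 2 ^ k := by exact_mod_cast Nat.lt_two_pow_self (n := k)
    have h4 : ((k : ℝ) + 1) ^ 2 ≤ 4 ^ k := by
      rw [show (4 : ℝ) ^ k = (2 ^ k) ^ 2 by rw [← pow_mul, mul_comm, pow_mul]; norm_num]
      gcongr
    have h5 : t k - 1 = ((σ - δ) - (δ + k) * (σ + k) / N) / N := by
      simp only [ht]
      field_simp
      ring
    rw [h5, abs_div, abs_of_pos hNpos, div_mul_eq_mul_div]
    gcongr
    have h6 : |(δ + k) * (σ + k) / N| ≤ (1 + k) * (|σ| + k) := by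
      rw [abs_div, abs_mul, abs_of_pos hNpos, abs_of_nonneg (a := (δ : ℝ) + k) (by positivity)]
      refine (div_le_self (by positivity) hN0).trans ?_
      have := abs_add_le σ (k : ℝ)
      rw [Nat.abs_cast] at this
      gcongr
    calc |σ - δ - (δ + k) * (σ + k) / N| ≤ |σ - δ| + |(δ + k) * (σ + k) / N| := abs_sub _ _
      _ ≤ (|σ| + 1) + (1 + k) * (|σ| + k) := by
          gcongr
          refine (abs_sub _ _).trans ?_
          rw [Nat.abs_cast]
          gcongr
      _ ≤ 2 * A * ((k : ℝ) + 1) ^ 2 := by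
          rw [hA]
          nlinarith [abs_nonneg σ, mul_nonneg (abs_nonneg σ) hk0,
            mul_nonneg (mul_nonneg (abs_nonneg σ) hk0) hk0]
      _ ≤ 2 * A * 4 ^ k := by gcongr
  change |p k - 1| ≤ _
  induction k with
  | zero => rw [hp0, sub_self, abs_zero]; positivity
  | succ k ih =>
    have h1 : p (k + 1) - 1 = p k * (t k - 1) + (p k - 1) := by rw [hps]; ring
    have h3 : (1 : ℝ) ≤ 4 * A - 1 := by linarith
    calc |p (k + 1) - 1| ≤ |p k| * |t k - 1| + |p k - 1| := by
          rw [h1, ← abs_mul]; exact abs_add_le _ _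
      _ ≤ A ^ k * (2 * A / N * 4 ^ k) + 2 * A / N * (4 * A) ^ k := by
          gcongr
          · exact (hbound k).1
          · exact htk k
      _ = 2 * A / N * (4 * A) ^ k * 2 := by rw [mul_pow]; ring
      _ ≤ 2 * A / N * (4 * A) ^ k * (4 * A) := by gcongr; linarith
      _ = _ := by rw [pow_succ]; ring

/-! ### Moments of the Jacobi weight -/

open MeasureTheory in
theorem beta_integrand_intervalIntegrable {s t : ℝ} (hs : 0 < s) (ht : 0 < t) :
    IntervalIntegrable (fun x : ℝ => x ^ (s - 1) * (1 - x) ^ (t - 1)) volume 0 1 := by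
  have h := (Complex.betaIntegral_convergent (u := s) (v := t) (by simpa) (by simpa)).norm
  refine h.congr ?_
  intro x hx
  rw [Set.uIoc_of_le zero_le_one] at hx
  have h1 : ((x : ℂ) ^ ((s : ℂ) - 1) * (1 - (x : ℂ)) ^ ((t : ℂ) - 1)) =
      ((x ^ (s - 1) * (1 - x) ^ (t - 1) : ℝ) : ℂ) := by
    push_cast
    rw [Complex.ofReal_cpow hx.1.le, Complex.ofReal_cpow (by linarith [hx.2])]
    push_cast
    rfl
  have h2 : 0 ≤ x ^ (s - 1) * (1 - x) ^ (t - 1) :=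
    mul_nonneg (Real.rpow_nonneg hx.1.le _) (Real.rpow_nonneg (by linarith [hx.2]) _)
  simp only [h1, Complex.norm_real, Real.norm_eq_abs, abs_of_nonneg h2]

theorem integral_beta_integrand {s t : ℝ} (hs : 0 < s) (ht : 0 < t) :
    ∫ x in (0 : ℝ)..1, x ^ (s - 1) * (1 - x) ^ (t - 1) =
      Real.Gamma s * Real.Gamma t / Real.Gamma (s + t) := by
  have h := Complex.betaIntegral_eq_Gamma_mul_div (s : ℂ) t (by simpa) (by simpa)
  rw [← Complex.ofReal_add, Complex.Gamma_ofReal, Complex.Gamma_ofReal, Complex.Gamma_ofReal] at h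
  have h2 : Complex.betaIntegral (s : ℂ) t =
      ((∫ x in (0 : ℝ)..1, x ^ (s - 1) * (1 - x) ^ (t - 1) : ℝ) : ℂ) := by
    rw [Complex.betaIntegral, ← intervalIntegral.integral_ofReal]
    refine intervalIntegral.integral_congr fun x hx => ?_
    rw [Set.uIcc_of_le zero_le_one] at hx
    push_cast
    rw [Complex.ofReal_cpow hx.1, Complex.ofReal_cpow (by linarith [hx.2])]
    push_cast
    rfl
  rw [h2] at h
  exact_mod_cast h

theorem jacobi_weight_intervalIntegrable {α β : ℝ} (hα : -1 < α) (hβ : -1 < β) :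
    IntervalIntegrable (fun x : ℝ => x ^ α * (1 - x) ^ β) MeasureTheory.volume 0 1 := by
  have := beta_integrand_intervalIntegrable (s := α + 1) (t := β + 1) (by linarith) (by linarith)
  simpa using this

theorem integral_pow_mul_pow_mul_weight {α β : ℝ} (hα : -1 < α) (hβ : -1 < β) (k m : ℕ) :
    ∫ x in (0 : ℝ)..1, x ^ k * (1 - x) ^ m * (x ^ α * (1 - x) ^ β) =
      Real.Gamma (k + α + 1) * Real.Gamma (m + β + 1) / Real.Gamma (α + β + 2 + m + k) := by
  have h := integral_beta_integrand (s := k + α + 1) (t := m + β + 1)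
    (by linarith [Nat.cast_nonneg (α := ℝ) k]) (by linarith [Nat.cast_nonneg (α := ℝ) m])
  rw [show (k : ℝ) + α + 1 + (m + β + 1) = α + β + 2 + m + k by ring] at h
  -- Passing to the open interval gives the positive bases that splitting the real powers requires.
  rw [← h, intervalIntegral.integral_of_le zero_le_one, intervalIntegral.integral_of_le zero_le_one,
    MeasureTheory.integral_Ioc_eq_integral_Ioo, MeasureTheory.integral_Ioc_eq_integral_Ioo]
  refine MeasureTheory.setIntegral_congr_fun measurableSet_Ioo fun x hx => ?_
  have hx1 : 0 < 1 - x := by linarith [hx.2]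
  rw [add_sub_cancel_right, add_sub_cancel_right, Real.rpow_add hx.1, Real.rpow_add hx1,
    Real.rpow_natCast, Real.rpow_natCast]
  ring

theorem integral_sum_mul_weight {α β : ℝ} (hα : -1 < α) (hβ : -1 < β) (s : Finset ℕ) (c : ℕ → ℝ)
    (f : ℕ → ℝ → ℝ) (hf : ∀ k, Continuous (f k)) :
    ∫ x in (0 : ℝ)..1, (∑ k ∈ s, c k * f k x) * (x ^ α * (1 - x) ^ β) =
      ∑ k ∈ s, c k * ∫ x in (0 : ℝ)..1, f k x * (x ^ α * (1 - x) ^ β) := by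
  simp_rw [Finset.sum_mul, mul_assoc]
  rw [intervalIntegral.integral_finsetSum]
  · simp_rw [intervalIntegral.integral_const_mul]
  · intro k _
    exact ((jacobi_weight_intervalIntegrable hα hβ).continuousOn_mul
      (hf k).continuousOn).const_mul _

/-- The Chu–Vandermonde identity, with reciprocal Gamma values. -/
theorem sum_choose_mul_ascPochhammer_mul_inv_Gamma (n : ℕ) (b c : ℝ) :
    ∑ k ∈ Finset.range (n + 1), (n.choose k : ℝ) *
        ((-1) ^ k * (ascPochhammer ℝ k).eval b * (Real.Gamma (c + k))⁻¹) =
      (ascPochhammer ℝ n).eval (c - b) * (Real.Gamma (c + n))⁻¹ := by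
  induction n generalizing b c with
  | zero => simp
  | succ n ih =>
    -- Pascal's rule splits the sum in two; the shifted half is the same sum at `(b+1, c+1)`, which
    -- leaves `c - b` unchanged.
    have h := Finset.sum_choose_succ_mul
      (fun k _ => (-1) ^ k * (ascPochhammer ℝ k).eval b * (Real.Gamma (c + k))⁻¹) n
    rw [h, ih]
    have h2 : ∀ k ∈ Finset.range (n + 1), (n.choose k : ℝ) *
        ((-1) ^ (k + 1) * (ascPochhammer ℝ (k + 1)).eval b *
          (Real.Gamma (c + ((k + 1 : ℕ) : ℝ)))⁻¹) =
        -b * ((n.choose k : ℝ) * ((-1) ^ k * (ascPochhammer ℝ k).eval (b + 1) *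
          (Real.Gamma (c + 1 + k))⁻¹)) := by
      intro k _
      rw [ascPochhammer_succ_left, Polynomial.eval_mul, Polynomial.eval_X, Polynomial.eval_comp,
        Polynomial.eval_add, Polynomial.eval_X, Polynomial.eval_one, pow_succ]
      push_cast
      rw [show c + ((k : ℝ) + 1) = c + 1 + k by ring]
      ring
    rw [Finset.sum_congr rfl h2, ← Finset.mul_sum, ih, ascPochhammer_succ_eval,
      Real.inv_Gamma_eq (c + n), show c + 1 - (b + 1) = c - b by ring]
    push_cast
    rw [show c + 1 + (n : ℝ) = c + n + 1 by ring, show c + ((n : ℝ) + 1) = c + n + 1 by ring]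
    ring

/-! ### Jacobi polynomials as rescaled hypergeometric polynomials -/

/-- The coefficients of `jacobiQ`. -/
noncomputable def jacobiQCoef (α σ : ℝ) (n : ℕ) (k : ℕ) : ℝ :=
  jacCoef n (n + σ) k * besselCoef α k

/-- `n! / Γ(n+α+1) · P_n^{(α,β)}(1 - 2u)` with `σ = α + β + 1`. -/
noncomputable def jacobiQ (α σ : ℝ) (n : ℕ) : ℝ → ℝ := pser (jacobiQCoef α σ n)

theorem jacobiQ_eq_sum (α σ : ℝ) (n : ℕ) (u : ℝ) :
    jacobiQ α σ n u = ∑ k ∈ Finset.range (n + 1), jacobiQCoef α σ n k * u ^ k := by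
  refine tsum_eq_sum fun k hk => ?_
  rw [jacobiQCoef, jacCoef_nat_eq_zero _ _ (by simpa using hk), zero_mul, zero_mul]

theorem continuous_jacobiQ (α σ : ℝ) (n : ℕ) : Continuous (jacobiQ α σ n) := by
  simp_rw [funext (jacobiQ_eq_sum α σ n)]
  fun_prop

theorem jacCoef_nat_eq (n : ℕ) (y : ℝ) (k : ℕ) :
    jacCoef n y k = (k ! : ℝ) * n.choose k * (ascPochhammer ℝ k).eval y := by
  induction k with
  | zero => simp [jacCoef]
  | succ k ih =>
    have h : ((k : ℝ) + 1) * n.choose (k + 1) = (n - k) * n.choose k := by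
      rcases le_or_gt k n with hk | hk
      · have := Nat.choose_succ_right_eq n k
        rw [← Nat.cast_sub hk, mul_comm, mul_comm ((n - k : ℕ) : ℝ)]
        exact_mod_cast this
      · simp [Nat.choose_eq_zero_of_lt hk, Nat.choose_eq_zero_of_lt (hk.trans k.lt_succ_self)]
    rw [jacCoef_succ, ih, ascPochhammer_succ_eval, Nat.factorial_succ]
    push_cast
    linear_combination -((k ! : ℝ) * (ascPochhammer ℝ k).eval y * (y + k)) * h

theorem Gamma_mul_ascPochhammer {s : ℝ} (hs : 0 < s) (n : ℕ) :
    Real.Gamma s * (ascPochhammer ℝ n).eval s = Real.Gamma (s + n) := by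
  induction n with
  | zero => simp
  | succ n ih =>
    rw [ascPochhammer_succ_eval, ← mul_assoc, ih, Nat.cast_succ, ← add_assoc,
      Real.Gamma_add_one (by positivity), mul_comm]

theorem jacobiP_eq_jacobiQ {α : ℝ} (hα : -1 < α) (β : ℝ) (n : ℕ) (x : ℝ) :
    jacobiP α β n x =
      Real.Gamma (n + α + 1) / (n ! : ℝ) * jacobiQ α (α + β + 1) n ((1 - x) / 2) := by
  rw [jacobiP, jacobiQ_eq_sum, Finset.mul_sum, Finset.mul_sum]
  refine Finset.sum_congr rfl fun k hk => ?_
  have hkn : k ≤ n := Nat.lt_succ_iff.mp (Finset.mem_range.mp hk)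
  have hpos : 0 < α + k + 1 := by linarith [Nat.cast_nonneg (α := ℝ) k]
  have h := Gamma_mul_ascPochhammer hpos (n - k)
  rw [Nat.cast_sub hkn, show α + k + 1 + ((n : ℝ) - k) = n + α + 1 by ring] at h
  have hG := (Real.Gamma_pos_of_pos hpos).ne'
  rw [← h, jacobiQCoef, jacCoef_nat_eq, besselCoef, show (k : ℝ) + α + 1 = α + k + 1 by ring,
    show (x - 1) / 2 = (-1) * ((1 - x) / 2) by ring, mul_pow,
    show (n : ℝ) + (α + β + 1) = n + α + β + 1 by ring]
  have hk0 : (k ! : ℝ) ≠ 0 := by positivity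
  field_simp

/-- Testing against `(1-x)^m` rather than `x^m` makes the sum of Beta values a Chu–Vandermonde sum.
Its value contains `(m+1-n)_n`, which vanishes for `m < n`: this is orthogonality. -/
theorem integral_jacobiQ_mul_pow {α β : ℝ} (hα : -1 < α) (hβ : -1 < β) (n m : ℕ) :
    ∫ x in (0 : ℝ)..1, jacobiQ α (α + β + 1) n x * (1 - x) ^ m * (x ^ α * (1 - x) ^ β) =
      Real.Gamma (m + β + 1) * ((ascPochhammer ℝ n).eval ((m : ℝ) + 1 - n) *
        (Real.Gamma (α + β + 2 + m + n))⁻¹) := by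
  have h0 : ∀ x : ℝ, jacobiQ α (α + β + 1) n x * (1 - x) ^ m = ∑ k ∈ Finset.range (n + 1),
      jacobiQCoef α (α + β + 1) n k * (x ^ k * (1 - x) ^ m) := by
    intro x
    rw [jacobiQ_eq_sum, Finset.sum_mul]
    exact Finset.sum_congr rfl fun k _ => by ring
  simp_rw [h0]
  rw [integral_sum_mul_weight hα hβ _ _ (fun k x => x ^ k * (1 - x) ^ m) (fun k => by fun_prop)]
  simp_rw [integral_pow_mul_pow_mul_weight hα hβ]
  have h := sum_choose_mul_ascPochhammer_mul_inv_Gamma n (n + (α + β + 1)) (α + β + 2 + m)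
  rw [show α + β + 2 + (m : ℝ) - (n + (α + β + 1)) = m + 1 - n by ring] at h
  rw [← h, Finset.mul_sum]
  refine Finset.sum_congr rfl fun k _ => ?_
  have hG := (Real.Gamma_pos_of_pos
    (show 0 < (k : ℝ) + α + 1 by linarith [Nat.cast_nonneg (α := ℝ) k])).ne'
  have hk0 : (k ! : ℝ) ≠ 0 := by positivity
  rw [jacobiQCoef, jacCoef_nat_eq, besselCoef]
  field_simp

theorem integral_jacobiQ_mul_pow_eq_zero {α β : ℝ} (hα : -1 < α) (hβ : -1 < β) {n m : ℕ}
    (h : m < n) :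
    ∫ x in (0 : ℝ)..1, jacobiQ α (α + β + 1) n x * (1 - x) ^ m * (x ^ α * (1 - x) ^ β) = 0 := by
  rw [integral_jacobiQ_mul_pow hα hβ]
  have : (m : ℝ) + 1 - n = -((n - 1 - m : ℕ) : ℝ) := by
    rw [Nat.cast_sub (by omega), Nat.cast_sub (by omega)]; push_cast; ring
  rw [this, ascPochhammer_eval_neg_coe_nat_of_lt (by omega)]
  simp

theorem integral_jacobiQ_mul_pow_left {α β : ℝ} (hα : -1 < α) (hβ : -1 < β) {n k : ℕ}
    (h : k ≤ n) :
    ∫ x in (0 : ℝ)..1, jacobiQ α (α + β + 1) n x * x ^ k * (x ^ α * (1 - x) ^ β) =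
      if k = n then (-1) ^ n * (Real.Gamma (n + β + 1) * ((n ! : ℝ) *
        (Real.Gamma (α + β + 2 + n + n))⁻¹)) else 0 := by
  have h0 : ∀ x : ℝ, jacobiQ α (α + β + 1) n x * x ^ k = ∑ m ∈ Finset.range (k + 1),
      ((-1) ^ m * k.choose m) * (jacobiQ α (α + β + 1) n x * (1 - x) ^ m) := by
    intro x
    have : x ^ k = (-(1 - x) + 1) ^ k := by ring
    rw [this, add_pow, Finset.mul_sum]
    refine Finset.sum_congr rfl fun m _ => ?_
    rw [one_pow, neg_pow]
    ring
  simp_rw [h0]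
  rw [integral_sum_mul_weight hα hβ _ _ (fun m x => jacobiQ α (α + β + 1) n x * (1 - x) ^ m)
    (fun m => (continuous_jacobiQ _ _ _).mul (by fun_prop)), Finset.sum_range_succ,
    Finset.sum_eq_zero, zero_add]
  · split_ifs with hk
    · subst hk
      rw [integral_jacobiQ_mul_pow hα hβ, add_sub_cancel_left, ascPochhammer_eval_one,
        Nat.choose_self, Nat.cast_one, mul_one]
    · rw [integral_jacobiQ_mul_pow_eq_zero hα hβ (by omega), mul_zero]
  · intro m hm
    rw [integral_jacobiQ_mul_pow_eq_zero hα hβ (by have := Finset.mem_range.mp hm; omega), mul_zero]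

/-- Expand one factor in powers of x; by orthogonality only the leading term contributes. -/
theorem integral_jacobiQ_sq {α β : ℝ} (hα : -1 < α) (hβ : -1 < β) (n : ℕ) :
    ∫ x in (0 : ℝ)..1, jacobiQ α (α + β + 1) n x ^ 2 * (x ^ α * (1 - x) ^ β) =
      (n ! : ℝ) * (ascPochhammer ℝ n).eval (n + (α + β + 1)) * Real.Gamma (n + β + 1) /
        (Real.Gamma (n + α + 1) * Real.Gamma (α + β + 2 + n + n)) := by
  have h0 : ∀ x : ℝ, jacobiQ α (α + β + 1) n x ^ 2 = ∑ k ∈ Finset.range (n + 1),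
      jacobiQCoef α (α + β + 1) n k * (jacobiQ α (α + β + 1) n x * x ^ k) := by
    intro x
    rw [pow_two]
    nth_rewrite 2 [jacobiQ_eq_sum]
    rw [Finset.mul_sum]
    exact Finset.sum_congr rfl fun k _ => by ring
  simp_rw [h0]
  rw [integral_sum_mul_weight hα hβ _ _ (fun k x => jacobiQ α (α + β + 1) n x * x ^ k)
    (fun k => (continuous_jacobiQ _ _ _).mul (by fun_prop)), Finset.sum_range_succ,
    Finset.sum_eq_zero, zero_add]
  · rw [integral_jacobiQ_mul_pow_left hα hβ le_rfl, if_pos rfl, jacobiQCoef, jacCoef_nat_eq,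
      besselCoef, Nat.choose_self, Nat.cast_one, mul_one]
    have h1 : ((-1 : ℝ) ^ n) * (-1) ^ n = 1 := by rw [← mul_pow]; simp
    have hn0 : (n ! : ℝ) ≠ 0 := by positivity
    rw [div_eq_mul_inv, div_eq_mul_inv, mul_inv, mul_inv]
    field_simp
    rw [← pow_mul, mul_comm n 2, pow_mul]
    simp
  · intro k hk
    have hk' := Finset.mem_range.mp hk
    rw [integral_jacobiQ_mul_pow_left hα hβ hk'.le, if_neg hk'.ne, mul_zero]

/-- The reciprocal of the squared norm of `jacobiQ` for the weight `u^α (1-u)^β` on `[0,1]`. -/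
noncomputable def jacobiQWeight (α β : ℝ) (n : ℕ) : ℝ :=
  (∫ x in (0 : ℝ)..1, jacobiQ α (α + β + 1) n x ^ 2 * (x ^ α * (1 - x) ^ β))⁻¹

/-- Kept apart from `n ≥ 1`: the general formula would contain `σ Γ(σ)` with `σ = α+β+1`, which must
be read as `Γ(σ+1)` when `σ = 0`. -/
theorem jacobiQWeight_zero {α β : ℝ} (hα : -1 < α) (hβ : -1 < β) :
    jacobiQWeight α β 0 =
      Real.Gamma (α + 1) * Real.Gamma (α + β + 2) / Real.Gamma (β + 1) := by
  rw [jacobiQWeight, integral_jacobiQ_sq hα hβ]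
  simp

theorem jacobiQWeight_eq {α β : ℝ} (hα : -1 < α) (hβ : -1 < β) {n : ℕ} (hn : 1 ≤ n) :
    jacobiQWeight α β n = (2 * n + (α + β + 1)) *
      (Real.Gamma (n + α + 1) * Real.Gamma (n + (α + β + 1)) /
        ((n ! : ℝ) * Real.Gamma (n + β + 1))) := by
  have hn1 : (1 : ℝ) ≤ n := by exact_mod_cast hn
  have hpos : 0 < (n : ℝ) + (α + β + 1) := by linarith
  have h := Gamma_mul_ascPochhammer hpos n
  rw [jacobiQWeight, integral_jacobiQ_sq hα hβ, inv_div,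
    show α + β + 2 + (n : ℝ) + n = (n + (α + β + 1) + n) + 1 by ring,
    Real.Gamma_add_one (s := n + (α + β + 1) + n) (by positivity), ← h]
  have h1 : (ascPochhammer ℝ n).eval ((n : ℝ) + (α + β + 1)) ≠ 0 :=
    (ascPochhammer_pos n _ hpos).ne'
  field_simp
  ring

theorem jacobiNormSq_eq {α β : ℝ} (hα : -1 < α) (n : ℕ) :
    jacobiNormSq α β n = 2 ^ (α + β + 1) * (Real.Gamma (n + α + 1) / (n ! : ℝ)) ^ 2 *
      (jacobiQWeight α β n)⁻¹ := by
  have h := intervalIntegral.integral_comp_sub_mul (a := 0) (b := 1)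
    (fun x : ℝ => jacobiP α β n x ^ 2 * (1 - x) ^ α * (1 + x) ^ β) (c := 2) (by norm_num) 1
  norm_num at h
  have h' : jacobiNormSq α β n = 2 * ∫ x in (0 : ℝ)..1, jacobiP α β n (1 - 2 * x) ^ 2 *
      (2 * x) ^ α * (1 + (1 - 2 * x)) ^ β := by
    rw [h, jacobiNormSq]
    ring
  rw [h', jacobiQWeight, inv_inv, ← intervalIntegral.integral_const_mul,
    ← intervalIntegral.integral_const_mul]
  refine intervalIntegral.integral_congr fun x hx => ?_
  rw [Set.uIcc_of_le zero_le_one] at hx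
  have hx1 : 0 ≤ 1 - x := by linarith [hx.2]
  rw [jacobiP_eq_jacobiQ hα, show (1 - (1 - 2 * x)) / 2 = x by ring,
    show 1 + (1 - 2 * x) = 2 * (1 - x) by ring, Real.mul_rpow two_pos.le hx.1,
    Real.mul_rpow two_pos.le hx1, Real.rpow_add two_pos, Real.rpow_add two_pos, Real.rpow_one]
  ring

theorem jacobiNormSq_nonneg (α β : ℝ) (n : ℕ) : 0 ≤ jacobiNormSq α β n := by
  refine intervalIntegral.integral_nonneg (by norm_num) fun x hx => ?_
  have h1 : 0 ≤ 1 - x := by linarith [hx.2]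
  have h2 : 0 ≤ 1 + x := by linarith [hx.1]
  positivity

theorem jacobiP_mul_jacobiP_div_normSq {α β : ℝ} (hα : -1 < α) (n : ℕ) (x y : ℝ) :
    jacobiP α β n x * jacobiP α β n y / jacobiNormSq α β n = (2 ^ (α + β + 1))⁻¹ *
      (jacobiQWeight α β n * jacobiQ α (α + β + 1) n ((1 - x) / 2) *
        jacobiQ α (α + β + 1) n ((1 - y) / 2)) := by
  have hG : Real.Gamma (n + α + 1) ≠ 0 := (Real.Gamma_pos_of_pos
    (show 0 < (n : ℝ) + α + 1 by linarith [Nat.cast_nonneg (α := ℝ) n])).ne'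
  have hn0 : (n ! : ℝ) ≠ 0 := by positivity
  have h2 : (2 : ℝ) ^ (α + β + 1) ≠ 0 := (Real.rpow_pos_of_pos two_pos _).ne'
  rw [jacobiP_eq_jacobiQ hα, jacobiP_eq_jacobiQ hα, jacobiNormSq_eq hα, div_eq_mul_inv, mul_inv,
    inv_inv, mul_inv]
  field_simp

/-! ### Recurrences and the Christoffel–Darboux formula -/

/-- The coefficients of `jacobiR`. -/
noncomputable def jacobiRCoef (α σ : ℝ) (n : ℕ) (k : ℕ) : ℝ :=
  jacCoef ((n : ℝ) - 1) (n + σ) k * besselCoef (α + 1) k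

/-- A multiple of `P_{n-1}^{(α+1,β)}(1 - 2u)` with `σ = α + β + 1`. -/
noncomputable def jacobiR (α σ : ℝ) (n : ℕ) : ℝ → ℝ := pser (jacobiRCoef α σ n)

theorem jacobiQ_eq_sum_of_lt (α σ : ℝ) {n M : ℕ} (h : n < M) (u : ℝ) :
    jacobiQ α σ n u = ∑ k ∈ Finset.range M, jacobiQCoef α σ n k * u ^ k := by
  refine tsum_eq_sum fun k hk => ?_
  have : M ≤ k := by simpa using hk
  rw [jacobiQCoef, jacCoef_nat_eq_zero _ _ (by omega), zero_mul, zero_mul]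

theorem jacobiR_eq_sum_of_le (α σ : ℝ) {n M : ℕ} (hn : 1 ≤ n) (h : n ≤ M) (u : ℝ) :
    jacobiR α σ n u = ∑ k ∈ Finset.range M, jacobiRCoef α σ n k * u ^ k := by
  refine tsum_eq_sum fun k hk => ?_
  have : M ≤ k := by simpa using hk
  rw [jacobiRCoef, jacCoef_sub_one_eq_zero hn _ (by omega), zero_mul, zero_mul]

/-- Both coefficients of `u^{k+1}` contain `jacCoef n (n+1+σ) k`; the remaining factors differ by
`(k+1)(2n+σ+1)`, and the `k+1` turns the Bessel coefficient into one of order `α+1`. -/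
theorem jacobiQ_succ_sub (α σ : ℝ) (n : ℕ) (u : ℝ) :
    jacobiQ α σ (n + 1) u - jacobiQ α σ n u =
      -(2 * n + σ + 1) * (u * jacobiR α σ (n + 1) u) := by
  rw [jacobiQ_eq_sum_of_lt α σ (M := n + 2) (by omega), jacobiQ_eq_sum_of_lt α σ (M := n + 2)
    (by omega), jacobiR_eq_sum_of_le α σ (M := n + 1) (by omega) (by omega),
    ← Finset.sum_sub_distrib, Finset.sum_range_succ', Finset.mul_sum, Finset.mul_sum]
  have h0 : jacobiQCoef α σ (n + 1) 0 * u ^ 0 - jacobiQCoef α σ n 0 * u ^ 0 = 0 := by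
    simp [jacobiQCoef, jacCoef]
  rw [h0, add_zero]
  refine Finset.sum_congr rfl fun k _ => ?_
  have h1 := jacCoef_succ_left n (n + 1 + σ) k
  have h2 := jacCoef_succ_right n (n + σ) k
  have h3 := succ_mul_besselCoef_succ α k
  rw [show (n : ℝ) + σ + 1 = n + 1 + σ by ring] at h2
  simp only [jacobiQCoef, jacobiRCoef]
  push_cast
  rw [h1, h2, add_sub_cancel_right]
  linear_combination (jacCoef n (n + 1 + σ) k * (2 * n + σ + 1) * u ^ (k + 1)) * h3

/-- Coefficientwise this is `(n+α+1)(n+σ+k) - (n+β)(n-k) = (2n+σ)(k+α+1)` with `σ = α+β+1`. -/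
theorem jacobiR_recurrence (α β : ℝ) {n : ℕ} (hn : 1 ≤ n) (u : ℝ) :
    (n + (α + β + 1)) * (n + α + 1) * jacobiR α (α + β + 1) (n + 1) u -
      n * (n + β) * jacobiR α (α + β + 1) n u =
      (2 * n + (α + β + 1)) * jacobiQ α (α + β + 1) n u := by
  rw [jacobiQ_eq_sum_of_lt α _ (M := n + 1) (by omega),
    jacobiR_eq_sum_of_le α _ (M := n + 1) (by omega) (by omega),
    jacobiR_eq_sum_of_le α _ (M := n + 1) (by omega) (by omega),
    Finset.mul_sum, Finset.mul_sum, Finset.mul_sum, ← Finset.sum_sub_distrib]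
  refine Finset.sum_congr rfl fun k _ => ?_
  have h1 := mul_jacCoef_add_one n (n + (α + β + 1)) k
  have h2 := mul_jacCoef_sub_one n (n + (α + β + 1)) k
  have h3 := besselCoef_eq α k
  rw [show (n : ℝ) + (α + β + 1) + 1 = n + 1 + (α + β + 1) by ring] at h1
  simp only [jacobiQCoef, jacobiRCoef]
  push_cast
  rw [h3, add_sub_cancel_right]
  linear_combination (n + α + 1) * besselCoef (α + 1) k * u ^ k * h1 -
    (n + β) * besselCoef (α + 1) k * u ^ k * h2

/-- The Christoffel–Darboux coefficient. -/
noncomputable def cdCoef (α β : ℝ) (n : ℕ) : ℝ :=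
  Real.Gamma (n + α + 1) * Real.Gamma (n + (α + β + 1)) /
    (Real.Gamma n * Real.Gamma (n + β))

/-- Induction on n. Substituting `Q_{n+1} = Q_n - (2n+σ+1) u R_{n+1}`, the products `R_{n+1}(u)
R_{n+1}(v)` cancel by antisymmetry, and the recurrence for `R` leaves exactly the new summand. The
step uses the norm formula for `n ≥ 1`, so the base is `n = 1`. -/
theorem christoffel_darboux {α β : ℝ} (hα : -1 < α) (hβ : -1 < β) {n : ℕ} (hn : 1 ≤ n)
    (u v : ℝ) :
    (u - v) * ∑ j ∈ Finset.range n, jacobiQWeight α β j * jacobiQ α (α + β + 1) j u *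
        jacobiQ α (α + β + 1) j v =
      cdCoef α β n * (u * jacobiR α (α + β + 1) n u * jacobiQ α (α + β + 1) n v -
        jacobiQ α (α + β + 1) n u * (v * jacobiR α (α + β + 1) n v)) := by
  induction n, hn using Nat.le_induction with
  | base =>
    have h1 := jacobiQ_succ_sub α (α + β + 1) 0 u
    have h2 := jacobiQ_succ_sub α (α + β + 1) 0 v
    have h3 : ∀ w, jacobiQ α (α + β + 1) 0 w = (Real.Gamma (α + 1))⁻¹ := by
      intro w; simp [jacobiQ_eq_sum, jacobiQCoef, jacCoef, besselCoef]
    have h4 : ∀ w, jacobiR α (α + β + 1) 1 w = (Real.Gamma (α + 2))⁻¹ := by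
      intro w
      rw [jacobiR_eq_sum_of_le _ _ le_rfl le_rfl]
      simp [jacobiRCoef, jacCoef, besselCoef]
      ring_nf
    rw [zero_add, h3, h4] at h1 h2
    rw [Finset.sum_range_one, jacobiQWeight_zero hα hβ, cdCoef, h3, h3, h4, h4,
      eq_add_of_sub_eq h1, eq_add_of_sub_eq h2]
    have g1 := (Real.Gamma_pos_of_pos (show 0 < α + 1 by linarith)).ne'
    have g2 := (Real.Gamma_pos_of_pos (show 0 < α + 2 by linarith)).ne'
    have g3 := (Real.Gamma_pos_of_pos (show 0 < β + 1 by linarith)).ne'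
    push_cast
    rw [show 1 + α + 1 = α + 2 by ring, show 1 + (α + β + 1) = α + β + 2 by ring,
      show 1 + β = β + 1 by ring, Real.Gamma_one]
    field_simp
    ring
  | succ n hn ih =>
    have hn1 : (1 : ℝ) ≤ n := by exact_mod_cast hn
    rw [Finset.sum_range_succ, mul_add, ih, jacobiQWeight_eq hα hβ hn,
      eq_add_of_sub_eq (jacobiQ_succ_sub α (α + β + 1) n u),
      eq_add_of_sub_eq (jacobiQ_succ_sub α (α + β + 1) n v)]
    set D : ℝ := Real.Gamma (n + α + 1) * Real.Gamma (n + (α + β + 1)) /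
        ((n ! : ℝ) * Real.Gamma (n + β + 1)) with hD
    have g0 := (Real.Gamma_pos_of_pos (show (0 : ℝ) < n by linarith)).ne'
    have g1 := (Real.Gamma_pos_of_pos (show 0 < (n : ℝ) + β by linarith)).ne'
    have hB : cdCoef α β n = D * (n * (n + β)) := by
      rw [hD, cdCoef, ← Real.Gamma_nat_eq_factorial, Real.Gamma_add_one (s := (n : ℝ))
        (by linarith), Real.Gamma_add_one (s := (n : ℝ) + β) (by linarith)]
      have : (n : ℝ) + β ≠ 0 := by linarith
      field_simp
    have hB' : cdCoef α β (n + 1) = D * ((n + (α + β + 1)) * (n + α + 1)) := by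
      rw [hD, cdCoef, ← Real.Gamma_nat_eq_factorial]
      push_cast
      rw [show (n : ℝ) + 1 + α + 1 = n + α + 1 + 1 by ring,
        show (n : ℝ) + 1 + (α + β + 1) = n + (α + β + 1) + 1 by ring,
        show (n : ℝ) + 1 + β = n + β + 1 by ring,
        Real.Gamma_add_one (s := (n : ℝ) + α + 1) (by linarith),
        Real.Gamma_add_one (s := (n : ℝ) + (α + β + 1)) (by linarith)]
      ring
    have h1 := jacobiR_recurrence α β hn u
    have h2 := jacobiR_recurrence α β hn v
    rw [hB, hB']
    linear_combination D * jacobiQ α (α + β + 1) n u * v * h2 -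
      D * jacobiQ α (α + β + 1) n v * u * h1

/-! ### Rescaling at the hard edge -/

/-- The coefficients of the Jacobi series in the hard edge variable. -/
noncomputable def scaledCoef (δ : ℕ) (σ ν : ℝ) (N k : ℕ) : ℝ :=
  jacCoef ((N : ℝ) - δ) (N + σ) k / ((N : ℝ) ^ 2) ^ k * besselCoef ν k

theorem pser_scaledCoef_zero (α σ : ℝ) (N : ℕ) (z : ℝ) :
    pser (scaledCoef 0 σ α N) z = jacobiQ α σ N (z / (N : ℝ) ^ 2) := by
  refine tsum_congr fun k => ?_
  rw [scaledCoef, jacobiQCoef, div_pow, Nat.cast_zero, sub_zero]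
  ring

theorem pser_scaledCoef_one (α σ : ℝ) (N : ℕ) (z : ℝ) :
    pser (scaledCoef 1 σ (α + 1) N) z = jacobiR α σ N (z / (N : ℝ) ^ 2) := by
  refine tsum_congr fun k => ?_
  rw [scaledCoef, jacobiRCoef, div_pow, Nat.cast_one]
  ring

theorem exists_expBdd_scaledCoef {δ : ℕ} (hδ : δ ≤ 1) (σ ν : ℝ) :
    ∃ C B, 0 ≤ C ∧ 0 ≤ B ∧ ∀ N : ℕ, 1 ≤ N → ExpBdd C B (scaledCoef δ σ ν N) ∧
      ExpBdd (C / N) B (fun k => scaledCoef δ σ ν N k - besselCoef ν k) := by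
  obtain ⟨C, B, hC, hB, h⟩ := exists_expBdd_besselCoef ν
  have hA : 2 ≤ 2 + |σ| := by linarith [abs_nonneg σ]
  set A := 2 + |σ| with hAdef
  have hdiff : ∀ N : ℕ, 1 ≤ N →
      ExpBdd (2 * A * C / N) (4 * A * B) (fun k => scaledCoef δ σ ν N k - besselCoef ν k) := by
    intro N hN k
    have h1 := abs_jacCoef_div_sub_one_le hδ σ hN k
    rw [← hAdef] at h1
    simp only [scaledCoef]
    rw [← sub_one_mul, abs_mul, mul_pow]
    calc _ ≤ 2 * A / N * (4 * A) ^ k * (C * (B ^ k / (k ! : ℝ))) :=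
          mul_le_mul h1 (h k) (abs_nonneg _) (by positivity)
      _ = _ := by ring
  have hle : ∀ N : ℕ, 1 ≤ N → 2 * A * C / N ≤ (1 + 2 * A) * C / N := by
    intro N hN
    gcongr
    linarith
  refine ⟨(1 + 2 * A) * C, 4 * A * B, by positivity, by positivity, fun N hN => ⟨fun k => ?_,
    fun k => (hdiff N hN k).trans (mul_le_mul_of_nonneg_right (hle N hN) (by positivity))⟩⟩
  have h2 : |scaledCoef δ σ ν N k| ≤
      |scaledCoef δ σ ν N k - besselCoef ν k| + |besselCoef ν k| := by
    simpa using abs_add_le (scaledCoef δ σ ν N k - besselCoef ν k) (besselCoef ν k)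
  have h3 : 2 * A * C / N ≤ 2 * A * C :=
    div_le_self (by positivity) (by exact_mod_cast hN)
  have h4 : B ^ k ≤ (4 * A * B) ^ k := by
    gcongr
    nlinarith
  calc |scaledCoef δ σ ν N k|
      ≤ 2 * A * C * ((4 * A * B) ^ k / (k ! : ℝ)) + C * ((4 * A * B) ^ k / (k ! : ℝ)) := by
        refine h2.trans (add_le_add ((hdiff N hN k).trans ?_) ((h k).trans ?_))
        · exact mul_le_mul_of_nonneg_right h3 (by positivity)
        · gcongr
    _ = _ := by ring

/-- The divided difference `(x g(x) f(y) - f(x) y g(y)) / (x - y)` of two power series with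
coefficients `f` and `g`. -/
noncomputable def cdKernel (f g : ℕ → ℝ) (x y : ℝ) : ℝ :=
  (pser g x + y * pdd g x y) * pser f y - pdd f x y * (y * pser g y)

theorem sub_mul_cdKernel {C B C' B' : ℝ} {f g : ℕ → ℝ} (hf : ExpBdd C B f) (hg : ExpBdd C' B' g)
    (x y : ℝ) :
    (x - y) * cdKernel f g x y = x * pser g x * pser f y - pser f x * (y * pser g y) := by
  have h1 := hf.sub_mul_pdd x y
  have h2 := hg.sub_mul_pdd x y
  rw [cdKernel]
  linear_combination y * pser f y * h2 - y * pser g y * h1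

theorem hasDerivAt_of_eq_sub_mul {F k : ℝ → ℝ} {y : ℝ} (hk : ContinuousAt k y)
    (h : ∀ x, F x = (x - y) * k x) : HasDerivAt F (k y) y := by
  rw [hasDerivAt_iff_tendsto_slope]
  refine (hk.tendsto.mono_left nhdsWithin_le_nhds).congr' ?_
  filter_upwards [self_mem_nhdsWithin] with x hx
  rw [slope_def_field, h, h, sub_self, zero_mul, sub_zero,
    mul_div_cancel_left₀ _ (sub_ne_zero.mpr hx)]

theorem hasDerivAt_cdKernel {C B C' B' : ℝ} {f g : ℕ → ℝ} (hf : ExpBdd C B f)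
    (hg : ExpBdd C' B' g) (y : ℝ) :
    HasDerivAt (fun x => x * pser g x * pser f y - pser f x * (y * pser g y))
      (cdKernel f g y y) y := by
  have h := (((hasDerivAt_id y).mul (hg.hasDerivAt_pser y)).mul_const (pser f y)).sub
    ((hf.hasDerivAt_pser y).mul_const (y * pser g y))
  refine h.congr_deriv ?_
  simp only [cdKernel, id, one_mul]

/-- Off the diagonal, divide Christoffel–Darboux by `x - y`. On it, both sides are the derivative in
x of the same numerator at `x = y`. -/
theorem sum_jacobiQ_eq_cdKernel {α β : ℝ} (hα : -1 < α) (hβ : -1 < β) {N : ℕ} (hN : 1 ≤ N)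
    (x y : ℝ) :
    ∑ j ∈ Finset.range N, jacobiQWeight α β j * jacobiQ α (α + β + 1) j (x / (N : ℝ) ^ 2) *
        jacobiQ α (α + β + 1) j (y / (N : ℝ) ^ 2) =
      cdCoef α β N * cdKernel (scaledCoef 0 (α + β + 1) α N)
        (scaledCoef 1 (α + β + 1) (α + 1) N) x y := by
  obtain ⟨C, B, -, -, hf⟩ := exists_expBdd_scaledCoef (zero_le_one) (α + β + 1) α
  obtain ⟨C', B', -, -, hg⟩ := exists_expBdd_scaledCoef (le_refl 1) (α + β + 1) (α + 1)
  have hN0 : (N : ℝ) ≠ 0 := by positivity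
  set k : ℝ → ℝ := fun x => ∑ j ∈ Finset.range N, jacobiQWeight α β j *
    jacobiQ α (α + β + 1) j (x / (N : ℝ) ^ 2) * jacobiQ α (α + β + 1) j (y / (N : ℝ) ^ 2) with hk
  have hcont : Continuous k := by
    refine continuous_finsetSum _ fun j _ => ?_
    have := (continuous_jacobiQ α (α + β + 1) j).comp
      (continuous_id.div_const ((N : ℝ) ^ 2))
    exact (continuous_const.mul this).mul continuous_const
  have hCD : ∀ x, cdCoef α β N * (x * pser (scaledCoef 1 (α + β + 1) (α + 1) N) x *
      pser (scaledCoef 0 (α + β + 1) α N) y - pser (scaledCoef 0 (α + β + 1) α N) x *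
        (y * pser (scaledCoef 1 (α + β + 1) (α + 1) N) y)) = (x - y) * k x := by
    intro x
    have h := christoffel_darboux hα hβ hN (x / (N : ℝ) ^ 2) (y / (N : ℝ) ^ 2)
    simp only [pser_scaledCoef_zero, pser_scaledCoef_one, hk]
    rw [← sub_div, div_mul_eq_mul_div, div_eq_iff (by positivity)] at h
    rw [h]
    field_simp
  change k x = _
  rcases eq_or_ne x y with rfl | hxy
  · exact (hasDerivAt_of_eq_sub_mul hcont.continuousAt hCD).unique
      ((hasDerivAt_cdKernel (hf N hN).1 (hg N hN).1 x).const_mul (cdCoef α β N))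
  · refine mul_left_cancel₀ (sub_ne_zero.mpr hxy) ?_
    rw [← hCD, ← sub_mul_cdKernel (hf N hN).1 (hg N hN).1, mul_left_comm]

/-! ### Approximation up to `O(e)` along a filter -/

section Approximation

open Filter Asymptotics Topology

/-- `f = g + O(e)` along `l`, with `g` bounded. -/
def ApproxBy {X : Type*} (l : Filter X) (e f g : X → ℝ) : Prop :=
  (fun x => f x - g x) =O[l] e ∧ g =O[l] fun _ => (1 : ℝ)

namespace ApproxBy

variable {X Y : Type*} {l : Filter X} {e f g f' g' : X → ℝ}

theorem refl (hg : g =O[l] fun _ => (1 : ℝ)) : ApproxBy l e g g :=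
  ⟨by simpa using isBigO_zero e l, hg⟩

theorem isBigO_one (h : ApproxBy l e f g) (he : e =O[l] fun _ => (1 : ℝ)) :
    f =O[l] fun _ => (1 : ℝ) := by
  simpa using (h.1.trans he).add h.2

theorem add (h : ApproxBy l e f g) (h' : ApproxBy l e f' g') :
    ApproxBy l e (fun x => f x + f' x) (fun x => g x + g' x) :=
  ⟨(h.1.add h'.1).congr_left fun x => by ring, h.2.add h'.2⟩

theorem sub (h : ApproxBy l e f g) (h' : ApproxBy l e f' g') :
    ApproxBy l e (fun x => f x - f' x) (fun x => g x - g' x) :=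
  ⟨(h.1.sub h'.1).congr_left fun x => by ring, h.2.sub h'.2⟩

/-- From `f f' - g g' = (f - g) f' + g (f' - g')`; this is why `ApproxBy` also records that `g` is
bounded. -/
theorem mul (he : e =O[l] fun _ => (1 : ℝ)) (h : ApproxBy l e f g) (h' : ApproxBy l e f' g') :
    ApproxBy l e (fun x => f x * f' x) (fun x => g x * g' x) := by
  refine ⟨?_, by simpa using h.2.mul h'.2⟩
  have h1 : (fun x => (f x - g x) * f' x) =O[l] e := by
    simpa using h.1.mul (h'.isBigO_one he)
  have h2 : (fun x => g x * (f' x - g' x)) =O[l] e := by simpa using h.2.mul h'.1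
  exact (h1.add h2).congr_left fun x => by ring

theorem inv_one (he : Tendsto e l (𝓝 0)) (h : ApproxBy l e f fun _ => 1) :
    ApproxBy l e (fun x => (f x)⁻¹) fun _ => 1 := by
  refine ⟨?_, h.2⟩
  have hf : Tendsto f l (𝓝 1) := by
    simpa using (h.1.trans_tendsto he).add_const 1
  have h1 : (fun x => (f x)⁻¹) =O[l] fun _ => (1 : ℝ) := (hf.inv₀ one_ne_zero).isBigO_one ℝ
  have h2 : (fun x => -((f x - 1) * (f x)⁻¹)) =O[l] e := by
    simpa using (h.1.mul h1).neg_left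
  refine h2.congr' ?_ EventuallyEq.rfl
  filter_upwards [hf.eventually_ne one_ne_zero] with x hx
  field_simp
  ring

theorem congr' (h : ApproxBy l e f g) (hf : f =ᶠ[l] f') : ApproxBy l e f' g :=
  ⟨h.1.congr' (hf.sub EventuallyEq.rfl) EventuallyEq.rfl, h.2⟩

theorem comp_tendsto {l' : Filter Y} {k : Y → X} (h : ApproxBy l e f g) (hk : Tendsto k l' l) :
    ApproxBy l' (e ∘ k) (f ∘ k) (g ∘ k) :=
  ⟨h.1.comp_tendsto hk, h.2.comp_tendsto hk⟩

theorem of_bound {C C' : ℝ} (h : ∀ᶠ x in l, |f x - g x| ≤ C * |e x|) (hg : ∀ᶠ x in l, |g x| ≤ C') :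
    ApproxBy l e f g :=
  ⟨.of_bound C h, .of_bound C' (by simpa using hg)⟩

end ApproxBy

/-! ### Ratios of Gamma values -/

/-- Log-convexity of Gamma, used twice: `n+c` lies between `n` and `n+1` (upper bound), and `n+1`
between `n+c` and `n+c+1` (lower bound). -/
theorem one_sub_le_Gamma_ratio {c : ℝ} (h0 : 0 < c) (h1 : c < 1) {n : ℝ} (hn : 0 < n) :
    1 - c / n ≤ Real.Gamma (n + c) / (Real.Gamma n * n ^ c) ∧
      Real.Gamma (n + c) / (Real.Gamma n * n ^ c) ≤ 1 := by
  have hG := Real.Gamma_pos_of_pos hn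
  have hGc := Real.Gamma_pos_of_pos (show 0 < n + c by linarith)
  have hc1 : 0 < 1 - c := by linarith
  have hnc : 0 < n ^ c := Real.rpow_pos_of_pos hn c
  constructor
  · have h := Real.Gamma_mul_add_mul_le_rpow_Gamma_mul_rpow_Gamma (s := n + c) (t := n + c + 1)
      (by linarith) (by linarith) h0 hc1 (by ring)
    rw [show c * (n + c) + (1 - c) * (n + c + 1) = n + 1 by ring, Real.Gamma_add_one hn.ne',
      Real.Gamma_add_one (s := n + c) (by linarith), Real.mul_rpow (by linarith) hGc.le,
      mul_left_comm, ← Real.rpow_add hGc, show c + (1 - c) = 1 by ring, Real.rpow_one] at h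
    have h2 : (n + c) ^ (1 - c) ≤ n ^ (1 - c) * (1 + c / n) := by
      rw [show n + c = n * (1 + c / n) by field_simp, Real.mul_rpow hn.le (by positivity)]
      gcongr
      exact Real.rpow_le_self_of_one_le (by linarith [div_pos h0 hn]) (by linarith)
    have h3 : n ^ c * n ^ (1 - c) = n := by
      rw [← Real.rpow_add hn, show c + (1 - c) = 1 by ring, Real.rpow_one]
    rw [le_div_iff₀ (by positivity)]
    have hx : 0 < n ^ (1 - c) := Real.rpow_pos_of_pos hn _
    have h4 : n * Real.Gamma n ≤ n ^ (1 - c) * (1 + c / n) * Real.Gamma (n + c) :=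
      h.trans (by gcongr)
    have h5 : n ^ c * Real.Gamma n ≤ (1 + c / n) * Real.Gamma (n + c) := by
      refine le_of_mul_le_mul_left ?_ hx
      calc n ^ (1 - c) * (n ^ c * Real.Gamma n) = n * Real.Gamma n := by
            linear_combination Real.Gamma n * h3
        _ ≤ _ := h4
        _ = _ := by ring
    have hcn : 0 < c / n := div_pos h0 hn
    rcases le_or_gt (1 - c / n) 0 with hneg | hpos
    · exact (mul_nonpos_of_nonpos_of_nonneg hneg (by positivity)).trans hGc.le
    · calc (1 - c / n) * (Real.Gamma n * n ^ c) = (1 - c / n) * (n ^ c * Real.Gamma n) := by ring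
        _ ≤ (1 - c / n) * ((1 + c / n) * Real.Gamma (n + c)) := by gcongr
        _ = (1 - (c / n) ^ 2) * Real.Gamma (n + c) := by ring
        _ ≤ 1 * Real.Gamma (n + c) := by gcongr; nlinarith
        _ = _ := one_mul _
  · have h := Real.Gamma_mul_add_mul_le_rpow_Gamma_mul_rpow_Gamma (s := n) (t := n + 1)
      hn (by linarith) hc1 h0 (by ring)
    rw [show (1 - c) * n + c * (n + 1) = n + c by ring, Real.Gamma_add_one hn.ne',
      Real.mul_rpow hn.le hG.le, mul_left_comm, ← Real.rpow_add hG,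
      show 1 - c + c = 1 by ring, Real.rpow_one] at h
    rw [div_le_one (by positivity)]
    linarith

theorem tendsto_inv_natCast : Tendsto (fun n : ℕ => (n : ℝ)⁻¹) atTop (𝓝 0) :=
  tendsto_inv_atTop_zero.comp tendsto_natCast_atTop_atTop

theorem approxBy_one_add_div (c : ℝ) :
    ApproxBy atTop (fun n : ℕ => (n : ℝ)⁻¹) (fun n => 1 + c / n) fun _ => 1 :=
  .of_bound (C := |c|) (C' := 1) (.of_forall fun n => by
    rw [add_sub_cancel_left, div_eq_mul_inv, abs_mul]) (.of_forall fun n => by simp)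

theorem approxBy_Gamma_ratio (c : ℝ) :
    ApproxBy atTop (fun n : ℕ => (n : ℝ)⁻¹)
      (fun n => Real.Gamma (n + c) / (Real.Gamma n * (n : ℝ) ^ c)) fun _ => 1 := by
  have he := tendsto_inv_natCast
  have he1 := he.isBigO_one ℝ
  -- Log-convexity settles the fractional part of `c`; each integer shift, up or down, changes the
  -- ratio by a factor `1 + d/n` or its inverse.
  suffices ∀ m : ℤ, ApproxBy atTop (fun n : ℕ => (n : ℝ)⁻¹)
      (fun n => Real.Gamma (n + (Int.fract c + m)) / (Real.Gamma n * (n : ℝ) ^ (Int.fract c + m)))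
      fun _ => 1 by
    simpa only [Int.fract_add_floor] using this ⌊c⌋
  have hlarge : ∀ d : ℝ, ∀ᶠ n : ℕ in atTop, 0 < (n : ℝ) ∧ 0 < (n : ℝ) + d := fun d => by
    filter_upwards [eventually_gt_atTop 0,
      (tendsto_natCast_atTop_atTop (R := ℝ)).eventually_gt_atTop (-d)] with n h1 h2
    exact ⟨by exact_mod_cast h1, by linarith⟩
  have hstep : ∀ d : ℝ, ∀ᶠ n : ℕ in atTop,
      Real.Gamma (n + (d + 1)) / (Real.Gamma n * (n : ℝ) ^ (d + 1)) =
        Real.Gamma (n + d) / (Real.Gamma n * (n : ℝ) ^ d) * (1 + d / n) := fun d => by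
    filter_upwards [hlarge d] with n hn
    have h1 := (Real.Gamma_pos_of_pos hn.1).ne'
    have h2 := (Real.rpow_pos_of_pos hn.1 d).ne'
    have h3 := hn.1.ne'
    rw [← add_assoc, Real.Gamma_add_one hn.2.ne', Real.rpow_add hn.1, Real.rpow_one]
    field_simp
  intro m
  induction m using Int.induction_on with
  | zero =>
    simp only [Int.cast_zero, add_zero]
    rcases (Int.fract_nonneg c).eq_or_lt with h | h
    · refine (ApproxBy.refl (isBigO_refl _ _)).congr' ?_
      filter_upwards [hlarge 0] with n hn
      rw [← h, add_zero, Real.rpow_zero, mul_one, div_self (Real.Gamma_pos_of_pos hn.1).ne']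
    · refine .of_bound (C := Int.fract c) (C' := 1) ?_ (.of_forall fun n => by simp)
      filter_upwards [hlarge 0] with n hn
      have := one_sub_le_Gamma_ratio h (Int.fract_lt_one c) hn.1
      rw [abs_of_nonpos (by linarith), abs_of_pos (inv_pos.mpr hn.1), ← div_eq_mul_inv]
      linarith
  | succ i ih =>
    have h := ih.mul he1 (approxBy_one_add_div (Int.fract c + (i : ℤ)))
    simp only [mul_one] at h
    refine h.congr' ?_
    filter_upwards [hstep (Int.fract c + (i : ℤ))] with n hn
    rw [← hn]
    push_cast
    rw [add_assoc]
  | pred i ih =>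
    have h := ih.mul he1 ((approxBy_one_add_div (Int.fract c + (-(i : ℤ) - 1 : ℤ))).inv_one he)
    simp only [mul_one] at h
    refine h.congr' ?_
    filter_upwards [hstep (Int.fract c + (-(i : ℤ) - 1 : ℤ)),
      hlarge (Int.fract c + (-(i : ℤ) - 1 : ℤ))] with n hn hl
    rw [show Int.fract c + ((-(i : ℤ) : ℤ) : ℝ) = Int.fract c + ((-(i : ℤ) - 1 : ℤ) : ℝ) + 1 by
      push_cast; ring, hn]
    refine mul_inv_cancel_right₀ ?_ _
    rw [one_add_div hl.1.ne']
    exact (div_pos hl.2 hl.1).ne'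

/-- The powers of n combine as `(α+1) + (α+β+1) - β = 2α+2`. -/
theorem approxBy_cdCoef (α β : ℝ) :
    ApproxBy atTop (fun n : ℕ => (n : ℝ)⁻¹)
      (fun n => cdCoef α β n / (n : ℝ) ^ (2 * α + 2)) fun _ => 1 := by
  have he := tendsto_inv_natCast
  have he1 := he.isBigO_one ℝ
  have h := ((approxBy_Gamma_ratio (α + 1)).mul he1 (approxBy_Gamma_ratio (α + β + 1))).mul he1
    ((approxBy_Gamma_ratio β).inv_one he)
  simp only [mul_one] at h
  refine h.congr' ?_
  filter_upwards [eventually_gt_atTop 0,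
    (tendsto_natCast_atTop_atTop (R := ℝ)).eventually_gt_atTop (-β)] with n hn hnβ
  have hn0 : (0 : ℝ) < n := by exact_mod_cast hn
  have h1 := (Real.Gamma_pos_of_pos hn0).ne'
  have h2 := (Real.Gamma_pos_of_pos (show 0 < (n : ℝ) + β by linarith)).ne'
  have h3 : (n : ℝ) ^ (α + 1) * (n : ℝ) ^ (α + β + 1) = (n : ℝ) ^ (2 * α + 2) * (n : ℝ) ^ β := by
    rw [← Real.rpow_add hn0, ← Real.rpow_add hn0]
    ring_nf
  have h4 := (Real.rpow_pos_of_pos hn0 (α + 1)).ne'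
  have h5 := (Real.rpow_pos_of_pos hn0 (α + β + 1)).ne'
  have h6 := (Real.rpow_pos_of_pos hn0 (2 * α + 2)).ne'
  have h7 := (Real.rpow_pos_of_pos hn0 β).ne'
  rw [cdCoef, ← add_assoc (n : ℝ) α 1]
  generalize (n : ℝ) ^ (α + 1) = p1 at *
  generalize (n : ℝ) ^ (α + β + 1) = p2 at *
  generalize (n : ℝ) ^ (2 * α + 2) = p3 at *
  generalize (n : ℝ) ^ β = p4 at *
  generalize Real.Gamma (n + α + 1) = g1
  generalize Real.Gamma (n + (α + β + 1)) = g2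
  field_simp
  linear_combination -g1 * g2 * h3

/-! ### Uniform convergence of the rescaled kernel -/

section Uniform

variable {X : Type*} {l : Filter X} {N : X → ℕ} {x y : X → ℝ} {R : ℝ}

theorem approxBy_scaledCoef {δ : ℕ} (hδ : δ ≤ 1) (σ ν : ℝ) (hN : Tendsto N l atTop)
    (hR : 1 ≤ R) (hx : ∀ᶠ p in l, |x p| ≤ R) (hy : ∀ᶠ p in l, |y p| ≤ R) :
    ApproxBy l (fun p => (N p : ℝ)⁻¹) (fun p => pser (scaledCoef δ σ ν (N p)) (x p))
        (fun p => pser (besselCoef ν) (x p)) ∧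
      ApproxBy l (fun p => (N p : ℝ)⁻¹) (fun p => pdd (scaledCoef δ σ ν (N p)) (x p) (y p))
        (fun p => pdd (besselCoef ν) (x p) (y p)) := by
  obtain ⟨C, B, hC, hB, h⟩ := exists_expBdd_scaledCoef hδ σ ν
  obtain ⟨C', B', hC', hB', h'⟩ := exists_expBdd_besselCoef ν
  have hN1 := hN.eventually_ge_atTop 1
  constructor
  · refine .of_bound (C := C * Real.exp (B * R)) (C' := C' * Real.exp (B' * R)) ?_ ?_
    · filter_upwards [hN1, hx] with p hp hxp
      rw [← (h _ hp).1.pser_sub h']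
      refine ((h _ hp).2.abs_pser_le hxp).trans_eq ?_
      rw [abs_of_nonneg (by positivity)]
      ring
    · filter_upwards [hx] with p hxp using h'.abs_pser_le hxp
  · refine .of_bound (C := C * Real.exp (B * (2 * R))) (C' := C' * Real.exp (B' * (2 * R))) ?_ ?_
    · filter_upwards [hN1, hx, hy] with p hp hxp hyp
      rw [← (h _ hp).1.pdd_sub h']
      refine ((h _ hp).2.abs_pdd_le hR hxp hyp).trans_eq ?_
      rw [abs_of_nonneg (by positivity)]
      ring
    · filter_upwards [hx, hy] with p hxp hyp using h'.abs_pdd_le hR hxp hyp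

theorem tendsto_inv_comp (hN : Tendsto N l atTop) : Tendsto (fun p => (N p : ℝ)⁻¹) l (𝓝 0) :=
  tendsto_inv_natCast.comp hN

theorem approxBy_cdKernel (σ α : ℝ) (hN : Tendsto N l atTop)
    (hR : 1 ≤ R) (hx : ∀ᶠ p in l, |x p| ≤ R) (hy : ∀ᶠ p in l, |y p| ≤ R) :
    ApproxBy l (fun p => (N p : ℝ)⁻¹)
      (fun p => cdKernel (scaledCoef 0 σ α (N p)) (scaledCoef 1 σ (α + 1) (N p)) (x p) (y p))
      (fun p => cdKernel (besselCoef α) (besselCoef (α + 1)) (x p) (y p)) := by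
  have he := (tendsto_inv_comp hN).isBigO_one ℝ
  have hf := approxBy_scaledCoef zero_le_one σ α hN hR hx hy
  have hf' := approxBy_scaledCoef zero_le_one σ α hN hR hy hx
  have hg := approxBy_scaledCoef le_rfl σ (α + 1) hN hR hx hy
  have hg' := approxBy_scaledCoef le_rfl σ (α + 1) hN hR hy hx
  have hyy : ApproxBy l (fun p => (N p : ℝ)⁻¹) y y := .refl (.of_bound R (by simpa using hy))
  exact ((hg.1.add (hyy.mul he hg.2)).mul he hf'.1).sub (hf.2.mul he (hyy.mul he hg'.1))

/-- Differentiability of `(1-t)^c` at `0` gives an error `O(x/N²)`, weakened here to `O(1/N)`. -/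
theorem approxBy_one_sub_rpow (c : ℝ) (hN : Tendsto N l atTop) (hx : ∀ᶠ p in l, |x p| ≤ R) :
    ApproxBy l (fun p => (N p : ℝ)⁻¹) (fun p => (1 - x p / (N p : ℝ) ^ 2) ^ c) fun _ => 1 := by
  refine ⟨?_, isBigO_refl _ _⟩
  have hO : (fun p => x p / (N p : ℝ) ^ 2) =O[l] fun p => (N p : ℝ)⁻¹ := by
    have h1 : x =O[l] fun _ => (1 : ℝ) := .of_bound R (by simpa using hx)
    have h2 := (h1.mul ((tendsto_inv_comp hN).isBigO_one ℝ)).mul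
      (isBigO_refl (fun p => (N p : ℝ)⁻¹) l)
    simp only [mul_one, one_mul] at h2
    refine h2.congr_left fun p => ?_
    rw [div_eq_mul_inv, pow_two, mul_inv, mul_assoc]
  have hd : HasDerivAt (fun t : ℝ => (1 - t) ^ c) (-1 * c * (1 - 0) ^ (c - 1)) 0 :=
    ((hasDerivAt_id (0 : ℝ)).const_sub 1).rpow_const (Or.inl (by norm_num))
  have h := hd.isBigO_sub.comp_tendsto (hO.trans_tendsto (tendsto_inv_comp hN))
  simp only [Function.comp_def, sub_zero, Real.one_rpow] at h
  exact h.trans hO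

end Uniform

end Approximation

/-! ### The Bessel kernel -/

theorem besselJ_eq {ν w : ℝ} (hw : 0 < w) :
    besselJ ν w = (w / 2) ^ ν * pser (besselCoef ν) ((w / 2) ^ 2) := by
  rw [besselJ, pser, ← tsum_mul_left]
  refine tsum_congr fun m => ?_
  have h2 : 0 < w / 2 := by positivity
  rw [besselCoef, Real.rpow_add h2, ← pow_mul, ← Real.rpow_natCast _ (2 * m)]
  push_cast
  ring

theorem pdd_besselCoef_self (ν z : ℝ) :
    pdd (besselCoef ν) z z = -pser (besselCoef (ν + 1)) z := by
  obtain ⟨C, B, -, -, h⟩ := exists_expBdd_besselCoef ν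
  rw [h.pdd_self_eq_pser, pser, pser, ← tsum_neg]
  exact tsum_congr fun k => by rw [succ_mul_besselCoef_succ, neg_mul]

/-- The three-term Bessel recurrence. The factor `k + ν` relating orders `ν-1` and `ν` splits into
`ν` and the operator `z d/dz`. -/
theorem pser_besselCoef_sub_one (ν z : ℝ) :
    pser (besselCoef (ν - 1)) z =
      ν * pser (besselCoef ν) z - z * pser (besselCoef (ν + 1)) z := by
  obtain ⟨C, B, -, -, h⟩ := exists_expBdd_besselCoef ν
  have h2 := mul_pdd_self (besselCoef ν) z
  have h3 : Summable fun k : ℕ => (k * besselCoef ν k) * z ^ k := by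
    have hs := h.dd_summable z z
    simp_rw [geom_sum₂_self] at hs
    refine (hs.mul_left z).congr fun k => ?_
    cases k with
    | zero => simp
    | succ k => rw [Nat.add_sub_cancel, pow_succ]; ring
  have h4 : pser (besselCoef (ν - 1)) z =
      ν * pser (besselCoef ν) z + pser (fun k => k * besselCoef ν k) z := by
    rw [pser, pser, pser, ← tsum_mul_left, ← ((h.summable z).mul_left ν).tsum_add h3]
    refine tsum_congr fun k => ?_
    rw [besselCoef_eq (ν - 1), sub_add_cancel]
    ring
  rw [h4, ← h2, pdd_besselCoef_self]
  ring

/-- `w J_ν'(w) = ν J_ν(w) - w J_{ν+1}(w)`, with the right side in terms of the power series. -/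
theorem mul_deriv_besselJ {ν w : ℝ} (hw : 0 < w) :
    w * deriv (besselJ ν) w = (w / 2) ^ ν * (ν * pser (besselCoef ν) ((w / 2) ^ 2) -
      2 * ((w / 2) ^ 2 * pser (besselCoef (ν + 1)) ((w / 2) ^ 2))) := by
  obtain ⟨C, B, -, -, h⟩ := exists_expBdd_besselCoef ν
  have h2 : 0 < w / 2 := by positivity
  have hid : HasDerivAt (fun t : ℝ => t / 2) (1 / 2) w := (hasDerivAt_id w).div_const 2
  have hd := (hid.rpow_const (p := ν) (Or.inl h2.ne')).mul
    ((h.hasDerivAt_pser ((w / 2) ^ 2)).comp w (hid.pow 2))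
  have he : besselJ ν =ᶠ[nhds w]
      (fun t : ℝ => (t / 2) ^ ν) * (pser (besselCoef ν) ∘ ((fun t : ℝ => t / 2) ^ 2)) := by
    filter_upwards [lt_mem_nhds hw] with t ht
    simp only [Pi.mul_apply, Function.comp_apply, Pi.pow_apply]
    exact besselJ_eq ht
  have hr : (w / 2) ^ ν = (w / 2) ^ (ν - 1) * (w / 2) := by
    rw [← Real.rpow_add_one h2.ne', sub_add_cancel]
  rw [(hd.congr_of_eventuallyEq he).deriv, pdd_besselCoef_self]
  simp only [Function.comp_apply, Pi.pow_apply]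
  rw [hr]
  push_cast
  ring

/-- Off the diagonal, the terms `ν J_ν(√x) J_ν(√y)` coming from the two derivatives cancel. On it,
the three-term recurrence at `ν` and at `ν+1` matches `J_ν² - J_{ν+1} J_{ν-1}` with the derivative
of the numerator. -/
theorem besselKernel_eq {ν x y : ℝ} (hx : 0 < x) (hy : 0 < y) :
    besselKernel ν x y = (√x / 2) ^ ν * (√y / 2) ^ ν / 4 *
      cdKernel (besselCoef ν) (besselCoef (ν + 1)) (x / 4) (y / 4) := by
  have hsx := Real.sqrt_pos.mpr hx
  have hsy := Real.sqrt_pos.mpr hy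
  have hx4 : (√x / 2) ^ 2 = x / 4 := by rw [div_pow, Real.sq_sqrt hx.le]; norm_num
  have hy4 : (√y / 2) ^ 2 = y / 4 := by rw [div_pow, Real.sq_sqrt hy.le]; norm_num
  rw [besselKernel]
  split_ifs with h
  · subst h
    have h2 : 0 < √x / 2 := by positivity
    have h1 := pser_besselCoef_sub_one (ν + 1) (x / 4)
    rw [add_sub_cancel_right] at h1
    have hp : (√x / 2) ^ (ν + 1) * (√x / 2) ^ (ν - 1) = (√x / 2) ^ ν * (√x / 2) ^ ν := by
      rw [← Real.rpow_add h2, ← Real.rpow_add h2]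
      ring_nf
    rw [besselJ_eq hsx, besselJ_eq hsx, besselJ_eq hsx, hx4, pser_besselCoef_sub_one ν, cdKernel,
      pdd_besselCoef_self, pdd_besselCoef_self]
    generalize pser (besselCoef ν) (x / 4) = f at *
    generalize pser (besselCoef (ν + 1)) (x / 4) = g at *
    generalize pser (besselCoef (ν + 1 + 1)) (x / 4) = g' at *
    rw [show ((√x / 2) ^ ν * f) ^ 2 - (√x / 2) ^ (ν + 1) * g *
      ((√x / 2) ^ (ν - 1) * (ν * f - x / 4 * g)) = (√x / 2) ^ ν * (√x / 2) ^ ν * f ^ 2 -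
        (√x / 2) ^ (ν + 1) * (√x / 2) ^ (ν - 1) * g * (ν * f - x / 4 * g) by ring, hp]
    linear_combination (√x / 2) ^ ν * (√x / 2) ^ ν / 4 * f * h1
  · obtain ⟨C, B, -, -, hf⟩ := exists_expBdd_besselCoef ν
    obtain ⟨C', B', -, -, hg⟩ := exists_expBdd_besselCoef (ν + 1)
    have hk := sub_mul_cdKernel hf hg (x / 4) (y / 4)
    have hxy : x - y ≠ 0 := sub_ne_zero.mpr h
    rw [mul_assoc, mul_deriv_besselJ hsy, mul_comm (deriv _ _), mul_deriv_besselJ hsx,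
      besselJ_eq hsx, besselJ_eq hsy, hx4, hy4, div_eq_iff (by simpa using hxy)]
    linear_combination (-2 * (√x / 2) ^ ν * (√y / 2) ^ ν) * hk

/-! ### The limit of the rescaled kernel -/

theorem joeS_eq {a b : ℝ} (ha : -2 < a) (N : ℕ) (u v : ℝ) :
    joeS a b N (1 - 2 * u) (1 - 2 * v) =
      4 * u * (1 - u) * (2 * u) ^ (a / 2) * (2 * (1 - u)) ^ (b / 2) *
        (2 * v) ^ (a / 2) * (2 * (1 - v)) ^ (b / 2) * (2 ^ (a + 1 + (b + 1) + 1))⁻¹ *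
        ∑ j ∈ Finset.range N, jacobiQWeight (a + 1) (b + 1) j *
          jacobiQ (a + 1) (a + 1 + (b + 1) + 1) j u * jacobiQ (a + 1) (a + 1 + (b + 1) + 1) j v := by
  rw [joeS, Finset.mul_sum]
  refine Finset.sum_congr rfl fun j _ => ?_
  have h := jacobiP_mul_jacobiP_div_normSq (α := a + 1) (β := b + 1) (by linarith) j
    (1 - 2 * u) (1 - 2 * v)
  rw [show (1 - (1 - 2 * u)) / 2 = u by ring, show (1 - (1 - 2 * v)) / 2 = v by ring,
    ← Real.mul_self_sqrt (jacobiNormSq_nonneg _ _ _), mul_div_mul_comm] at h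
  rw [joePhi, joePhi, show 1 - (1 - 2 * u) = 2 * u by ring,
    show 1 - (1 - 2 * v) = 2 * v by ring, show 1 + (1 - 2 * u) = 2 * (1 - u) by ring,
    show 1 + (1 - 2 * v) = 2 * (1 - v) by ring]
  linear_combination (4 * u * (1 - u) * (2 * u) ^ (a / 2) * (2 * (1 - u)) ^ (b / 2) *
        (2 * v) ^ (a / 2) * (2 * (1 - v)) ^ (b / 2)) * h

/-- The factor `√(x/y)` accounts for the asymmetry of `S_N`, whose `1 - x²` supplies the extra power
of x on the right. Both sides are compared as exponentials of combinations of logarithms. -/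
theorem sqrt_div_mul_sqrt_rpow {a x y : ℝ} (hx : 0 < x) (hy : 0 < y) :
    √(x / y) * ((√x / 2) ^ (a + 1) * (√y / 2) ^ (a + 1) / 4) =
      x * (x ^ (a / 2) * y ^ (a / 2)) * 4 ^ (-a - 2) := by
  have h4 : Real.log 4 = 2 * Real.log 2 := by
    rw [show (4 : ℝ) = 2 ^ 2 by norm_num, Real.log_pow, Nat.cast_ofNat]
  have hs : ∀ z : ℝ, 0 < z → √z / 2 = Real.exp (Real.log z / 2 - Real.log 2) := fun z hz => by
    rw [Real.exp_sub, Real.exp_half, Real.exp_log hz, Real.exp_log two_pos]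
  have h1 : √(x / y) = Real.exp ((Real.log x - Real.log y) / 2) := by
    rw [Real.exp_half, Real.exp_sub, Real.exp_log hx, Real.exp_log hy]
  have h2 : (4 : ℝ)⁻¹ = Real.exp (-(2 * Real.log 2)) := by
    rw [Real.exp_neg, ← h4, Real.exp_log (by norm_num)]
  have h3 : x * (x ^ (a / 2) * y ^ (a / 2)) = Real.exp (Real.log x) *
      (Real.exp (Real.log x * (a / 2)) * Real.exp (Real.log y * (a / 2))) := by
    rw [Real.exp_log hx, Real.rpow_def_of_pos hx, Real.rpow_def_of_pos hy]
  rw [h1, hs x hx, hs y hy, div_eq_mul_inv _ (4 : ℝ), h2, h3,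
    Real.rpow_def_of_pos (show (0 : ℝ) < 4 by norm_num), h4]
  simp only [← Real.exp_mul, ← Real.exp_add]
  congr 1
  ring

theorem hard_edge_prefactor {a b x y n : ℝ} (hx : 0 < x) (hy : 0 < y) (hn : 0 < n)
    (hxn : x / 4 / n ^ 2 < 1) (hyn : y / 4 / n ^ 2 < 1) :
    1 / (2 * n ^ 2) * (4 * (x / 4 / n ^ 2) * (1 - x / 4 / n ^ 2) * (2 * (x / 4 / n ^ 2)) ^ (a / 2) *
      (2 * (1 - x / 4 / n ^ 2)) ^ (b / 2) * (2 * (y / 4 / n ^ 2)) ^ (a / 2) *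
      (2 * (1 - y / 4 / n ^ 2)) ^ (b / 2) * (2 ^ (a + 1 + (b + 1) + 1))⁻¹) =
    x * (x ^ (a / 2) * y ^ (a / 2)) * 4 ^ (-a - 2) *
      ((1 - x / 4 / n ^ 2) ^ (1 + b / 2) * (1 - y / 4 / n ^ 2) ^ (b / 2)) /
        n ^ (2 * (a + 1) + 2) := by
  have hx1 : 0 < 1 - x / 4 / n ^ 2 := by linarith
  have hy1 : 0 < 1 - y / 4 / n ^ 2 := by linarith
  generalize 1 - x / 4 / n ^ 2 = p at *
  generalize 1 - y / 4 / n ^ 2 = q at *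
  have h4 : Real.log 4 = 2 * Real.log 2 := by
    rw [show (4 : ℝ) = 2 ^ 2 by norm_num, Real.log_pow, Nat.cast_ofNat]
  have h0 : 1 / (2 * n ^ 2) = Real.exp (-(Real.log 2 + (Real.log n + Real.log n))) := by
    rw [Real.exp_neg, Real.exp_add, Real.exp_add, Real.exp_log hn, Real.exp_log two_pos]
    ring
  have h1 : ∀ z : ℝ, 0 < z → 2 * (z / 4 / n ^ 2) =
      Real.exp (Real.log z - Real.log 2 - (Real.log n + Real.log n)) := fun z hz => by
    rw [Real.exp_sub, Real.exp_sub, Real.exp_add, Real.exp_log hn, Real.exp_log hz,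
      Real.exp_log two_pos]
    ring
  have h2 : ∀ z : ℝ, 0 < z → 2 * z = Real.exp (Real.log 2 + Real.log z) := fun z hz => by
    rw [Real.exp_add, Real.exp_log hz, Real.exp_log two_pos]
  have h3 : 4 * (x / 4 / n ^ 2) * p =
      Real.exp (Real.log x - (Real.log n + Real.log n) + Real.log p) := by
    rw [Real.exp_add, Real.exp_sub, Real.exp_add, Real.exp_log hn, Real.exp_log hx,
      Real.exp_log hx1]
    ring
  have h5 : x * (x ^ (a / 2) * y ^ (a / 2)) = Real.exp (Real.log x) *
      (Real.exp (Real.log x * (a / 2)) * Real.exp (Real.log y * (a / 2))) := by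
    rw [Real.exp_log hx, Real.rpow_def_of_pos hx, Real.rpow_def_of_pos hy]
  rw [h0, h3, h1 x hx, h1 y hy, h2 p hx1, h2 q hy1, h5, Real.rpow_def_of_pos hx1,
    Real.rpow_def_of_pos hy1, Real.rpow_def_of_pos hn, Real.rpow_def_of_pos two_pos,
    Real.rpow_def_of_pos (show (0 : ℝ) < 4 by norm_num), h4]
  simp only [← Real.exp_mul, ← Real.exp_add, ← Real.exp_neg, ← Real.exp_sub]
  congr 1
  ring

theorem mainTheorem10 (a b : ℝ) (ha : -2 < a) (hb : -2 < b)
    (K : Set ℝ) (hK : IsCompact K) (hKpos : K ⊆ Set.Ioi 0) :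
    ∃ (C : ℝ) (N₀ : ℕ), ∀ N : ℕ, N₀ ≤ N → ∀ x ∈ K, ∀ y ∈ K,
      |1 / (2 * (N : ℝ) ^ 2) *
            joeS a b N (1 - x / (2 * (N : ℝ) ^ 2)) (1 - y / (2 * (N : ℝ) ^ 2)) -
          √(x / y) * besselKernel (a + 1) x y| ≤ C / (N : ℝ) := by
  obtain ⟨R, hR1, hR⟩ : ∃ R : ℝ, 1 ≤ R ∧ ∀ x ∈ K, |x / 4| ≤ R := by
    obtain ⟨M, hM⟩ := hK.isBounded.exists_norm_le
    refine ⟨max 1 M, le_max_left _ _, fun x hx => ?_⟩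
    have h := hM x hx
    rw [Real.norm_eq_abs] at h
    rw [abs_div, abs_of_pos (show (0 : ℝ) < 4 by norm_num)]
    exact ((div_le_self (abs_nonneg _) (by norm_num)).trans h).trans (le_max_right _ _)
  -- Compactness inside `(0, ∞)` matters here: `a` may be negative, so the prefactor need not be
  -- bounded near `0`.
  obtain ⟨A, hA⟩ : ∃ A : ℝ, ∀ p ∈ K ×ˢ K,
      ‖p.1 * (p.1 ^ (a / 2) * p.2 ^ (a / 2)) * 4 ^ (-a - 2)‖ ≤ A := by
    refine (hK.prod hK).exists_bound_of_continuousOn ?_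
    have h1 : ContinuousOn (fun p : ℝ × ℝ => p.1 ^ (a / 2)) (K ×ˢ K) :=
      continuousOn_fst.rpow_const fun p hp => Or.inl (ne_of_gt (hKpos hp.1))
    have h2 : ContinuousOn (fun p : ℝ × ℝ => p.2 ^ (a / 2)) (K ×ˢ K) :=
      continuousOn_snd.rpow_const fun p hp => Or.inl (ne_of_gt (hKpos hp.2))
    exact (continuousOn_fst.mul (h1.mul h2)).mul continuousOn_const
  -- A big-O along this filter is a bound uniform in `(x, y) ∈ K × K` for all large N.
  set l : Filter (ℕ × (ℝ × ℝ)) := Filter.atTop ×ˢ Filter.principal (K ×ˢ K) with hl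
  have hN : Filter.Tendsto (Prod.fst : ℕ × (ℝ × ℝ) → ℕ) l Filter.atTop := Filter.tendsto_fst
  have hmem : ∀ᶠ p in l, p.2 ∈ K ×ˢ K := Filter.tendsto_snd.eventually
    (Filter.eventually_principal.mpr fun _ h => h)
  have hx : ∀ᶠ p in l, |p.2.1 / 4| ≤ R := hmem.mono fun p hp => hR _ hp.1
  have hy : ∀ᶠ p in l, |p.2.2 / 4| ≤ R := hmem.mono fun p hp => hR _ hp.2
  have he := (tendsto_inv_comp hN).isBigO_one ℝ
  have hker := approxBy_cdKernel (a + 1 + (b + 1) + 1) (a + 1) hN hR1 hx hy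
  have hpre : ApproxBy l (fun p => (p.1 : ℝ)⁻¹)
      (fun p => p.2.1 * (p.2.1 ^ (a / 2) * p.2.2 ^ (a / 2)) * 4 ^ (-a - 2))
      (fun p => p.2.1 * (p.2.1 ^ (a / 2) * p.2.2 ^ (a / 2)) * 4 ^ (-a - 2)) :=
    .refl (.of_bound A (hmem.mono fun p hp => by simpa using hA p.2 hp))
  have hcd := (approxBy_cdCoef (a + 1) (b + 1)).comp_tendsto hN
  have hall := ((hpre.mul he ((approxBy_one_sub_rpow (1 + b / 2) hN hx).mul he
    (approxBy_one_sub_rpow (b / 2) hN hy))).mul he hcd).mul he hker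
  obtain ⟨C, hC⟩ := hall.1.bound
  obtain ⟨N₀, hN₀⟩ := Filter.eventually_atTop.mp (Filter.eventually_prod_principal_iff.mp hC)
  -- `N > R ≥ 1` gives `x/4 < N²`, so the bases `1 - x/(4N²)` of the real powers are positive.
  obtain ⟨N₁, hN₁⟩ := exists_nat_gt R
  refine ⟨C, max N₀ N₁, fun N hN x hx y hy => ?_⟩
  have hNR : R < N := hN₁.trans_le (by exact_mod_cast (le_max_right _ _).trans hN)
  have hN1 : (1 : ℝ) < N := hR1.trans_lt hNR
  have hsmall : ∀ z ∈ K, z / 4 / (N : ℝ) ^ 2 < 1 := by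
    intro z hz
    rw [div_lt_one (by positivity)]
    have := (le_abs_self _).trans (hR z hz)
    nlinarith
  have h := hN₀ N ((le_max_left _ _).trans hN) (x, y) ⟨hx, hy⟩
  have hx0 : 0 < x := hKpos hx
  have hy0 : 0 < y := hKpos hy
  simp only [Function.comp_apply, Real.norm_eq_abs, mul_one] at h
  rw [abs_inv, Nat.abs_cast, ← div_eq_mul_inv] at h
  refine le_of_eq_of_le ?_ h
  congr 2
  · rw [show x / (2 * (N : ℝ) ^ 2) = 2 * (x / 4 / (N : ℝ) ^ 2) by field_simp; norm_num,
      show y / (2 * (N : ℝ) ^ 2) = 2 * (y / 4 / (N : ℝ) ^ 2) by field_simp; norm_num,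
      joeS_eq ha, ← mul_assoc, hard_edge_prefactor hx0 hy0 (by linarith) (hsmall x hx)
      (hsmall y hy), sum_jacobiQ_eq_cdKernel (by linarith) (by linarith)
        (by exact_mod_cast hN1.le)]
    ring
  · rw [besselKernel_eq hx0 hy0, ← mul_assoc, sqrt_div_mul_sqrt_rpow hx0 hy0]
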